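/- Let $X$ be a finite connected CW complex with fundamental group $G=\pi_1(X,x_0)$ and universal covering $\widetilde X$, let $C_*(\widetilde X)$ be the cellular chain complex of $\widetilde X$ with its $G$-action, and let $\rho:G\to \mathrm{GL}(l,\mathbb C)$ be a representation. For an integral domain $B$ with fraction field $\{B\}$ and a representation $\sigma:G\to\mathrm{GL}(l,B)$ put $$\beta_k(X,\sigma)=\dim_{\{B\}}\Big(H_k\big(C_*(\widetilde X)\otimes_\sigma B^l\big)\otimes_B\{B\}\Big),\qquad \beta^k(X,\sigma)=\dim_{\{B\}}\Big(H^k\big(\mathrm{Hom}_G(C_*(\widetilde X),B^l)\big)\otimes_B\{B\}\Big),$$ where in the tensor product $C_*(\widetilde X)$ is a right $G$-module through $x\cdot g=g^{-1}x$. Let $\rho^\vee(g)={}^t\rho(g)^{-1}$ be the contragredient representation. Let $\alpha\in H^1(X,\mathbb C)=\mathrm{Hom}(G,\mathbb C)$, let $m=\mathrm{Irr}\,\alpha$ be the rank of the group $\alpha(G)$, and factor $\alpha$ as $$G\xrightarrow{\ \phi\ }H_1(X,\mathbb Z)/\mathrm{Tors}\cong\mathbb Z^n\xrightarrow{\ p\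 }\mathbb Z^m\xrightarrow{\ \widetilde\alpha\ }\mathbb C$$ with $p$ an epimorphism and $\widetilde\alpha$ a monomorphism. Let $$\gamma_t(g)=e^{t\langle\alpha,g\rangle}\rho(g)\in\mathrm{GL}(l,\mathbb C)\quad(t\in\mathbb C),\qquad \widehat\gamma(g)=e^{t\langle\alpha,g\rangle}\rho(g)\in\mathrm{GL}(l,\mathbb C[[t]])$$ be the exponential and the formal exponential deformation of $\rho$. Let $L_m=\mathbb C[\mathbb Z^m]$, with fraction field $\{L_m\}$, let $\rho_p=\rho\otimes(p\circ\phi):G\to\mathrm{GL}(l,L_m)$, and put $$b_k(X,\rho,p)=\dim_{\{L_m\}}H_k\big(C_*(\widetilde X)\otimes_{\rho_p}\{L_m\}^l\big).$$ Then for every $k\ge 0$ the following holds. 1) There is a closed discrete set $S_k\subset\mathbb C$ such that for all $t\in\mathbb C\setminus S_k$ $$\beta_k(X,\gamma_t)=\beta_k(X,\widehat\gamma)=b_k(X,\rho,p)\qquad\text{and}\qquad \beta^k(X,\gamma_t)=\beta^k(X,\widehat\gamma)=b_k(X,\rho^\vee,p).$$ 2) Suppose that $\alpha\in H^1(X,\mathbb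 R)$, so that $\widetilde\alpha$ takes values in $\mathbb R$. Let $\widehat L$ be the Novikov completion of $L_m$, that is, the ring of formal series $\lambda=\sum_{a\in\mathbb Z^m}n_a a$ ($n_a\in\mathbb C$) such that for every $C\in\mathbb R$ the set $\{a\in\operatorname{supp}\lambda:\widetilde\alpha(a)\ge C\}$ is finite, and let $\widehat b_k^\rho(X,\alpha)$ be the rank over $\widehat L$ of $H_k\big(C_*(\widetilde X)\otimes_{\rho_p}\widehat L^{\,l}\big)$. Then also, for $t\in\mathbb C\setminus S_k$, $$\beta_k(X,\gamma_t)=\beta_k(X,\widehat\gamma)=\widehat b_k^\rho(X,\alpha)\qquad\text{and}\qquad \beta^k(X,\gamma_t)=\beta^k(X,\widehat\gamma)=\widehat b_k^{\rho^\vee}(X,\alpha).$$ -/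

import Mathlib

open scoped TensorProduct Matrix

noncomputable section

namespace ExpDeform

/-! ## The universal covering of a CW complex and its cellular chain complex -/

section UniversalCover

open Topology CategoryTheory

/-- The closed unit cube `[-1,1]ⁿ`, the domain of the characteristic maps of `n`-cells. -/
abbrev Cube (n : ℕ) : Type := Metric.closedBall (0 : Fin n → ℝ) 1

/-- The open unit cube. -/
abbrev OpenCube (n : ℕ) : Type := Metric.ball (0 : Fin n → ℝ) 1

/-- The boundary of the unit cube. -/
abbrev CubeBoundary (n : ℕ) : Type := Metric.sphere (0 : Fin n → ℝ) 1

def OpenCube.toCube {n : ℕ} (y : OpenCube n) : Cube n :=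
  ⟨y.1, Metric.ball_subset_closedBall y.2⟩

def CubeBoundary.toCube {n : ℕ} (y : CubeBoundary n) : Cube n :=
  ⟨y.1, Metric.sphere_subset_closedBall y.2⟩

variable {X : Type*} [TopologicalSpace X]

/-- The (underlying set of the) universal covering `X̃`: homotopy classes, relative to the end
points, of paths in `X` that start at the base point. Only its points are needed below. -/
def UnivCover (x₀ : X) : Type _ := Σ x : X, Path.Homotopic.Quotient x₀ x

/-- The left action of the fundamental group on homotopy classes of paths that start at `x₀`.
In Mathlib the product `g * h` in `FundamentalGroup X x₀` is the class of "first `h`, then `g`",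
so that the left action is `g • w = g⁻¹ · w` (first `g⁻¹`, then `w`). -/
def actPath {x₀ x : X} (g : FundamentalGroup X x₀) (w : Path.Homotopic.Quotient x₀ x) :
    Path.Homotopic.Quotient x₀ x :=
  (FundamentalGroup.toPath g).symm.trans w

theorem actPath_one {x₀ x : X} (w : Path.Homotopic.Quotient x₀ x) :
    actPath (1 : FundamentalGroup X x₀) w = w := by
  induction w using Path.Homotopic.Quotient.ind with
  | mk w =>
    simp only [actPath, FundamentalGroup.toPath, FundamentalGroup.one_def]
    rw [← Path.Homotopic.Quotient.mk_refl, ← Path.Homotopic.Quotient.mk_symm]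
    simp

theorem actPath_mul {x₀ x : X} (g h : FundamentalGroup X x₀)
    (w : Path.Homotopic.Quotient x₀ x) :
    actPath (g * h) w = actPath g (actPath h w) := by
  unfold actPath
  rw [← Path.Homotopic.Quotient.trans_assoc]
  congr 1
  exact mul_inv_rev g h

instance (x₀ : X) : MulAction (FundamentalGroup X x₀) (UnivCover x₀) where
  smul g P := ⟨P.1, actPath g P.2⟩
  one_smul P := Sigma.ext rfl (heq_of_eq (actPath_one P.2))
  mul_smul g h P := Sigma.ext rfl (heq_of_eq (actPath_mul g h P.2))

variable [CWComplex (Set.univ : Set X)]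

/-- The `n`-cells of the CW complex `X`. -/
abbrev XCell (X : Type*) [TopologicalSpace X] [CWComplex (Set.univ : Set X)] (n : ℕ) : Type _ :=
  RelCWComplex.cell (Set.univ : Set X) n

/-- The characteristic map of an `n`-cell of `X`. -/
def charMap {n : ℕ} (i : XCell X n) (y : Cube n) : X :=
  RelCWComplex.map (C := (Set.univ : Set X)) n i y.1

/-- The centre of an `n`-cell of `X`. -/
def cellCenter {n : ℕ} (i : XCell X n) : X :=
  RelCWComplex.map (C := (Set.univ : Set X)) n i 0

/-- The image under the characteristic map of the segment from the centre of the cube to `y`. -/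
def charPath {n : ℕ} (i : XCell X n) (y : Cube n) : Path (cellCenter i) (charMap i y) where
  toFun s := RelCWComplex.map (C := (Set.univ : Set X)) n i ((s : ℝ) • y.1)
  continuous_toFun := by
    refine (RelCWComplex.continuousOn (C := (Set.univ : Set X)) n i).comp_continuous
      (by fun_prop) fun s => ?_
    have hy := y.2
    rw [mem_closedBall_zero_iff] at hy ⊢
    rw [norm_smul, Real.norm_of_nonneg s.2.1]
    exact mul_le_one₀ s.2.2 (norm_nonneg _) hy
  source' := by simp [cellCenter]
  target' := by simp [charMap]

/-- The `n`-cells of `X̃`: the lifts of the `n`-cells of `X`, a lift being given by a point of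
`X̃` over the centre of the cell. -/
def LiftedCell (x₀ : X) (n : ℕ) : Type _ :=
  Σ i : XCell X n, Path.Homotopic.Quotient x₀ (cellCenter i)

instance (x₀ : X) (n : ℕ) : MulAction (FundamentalGroup X x₀) (LiftedCell x₀ n) where
  smul g e := ⟨e.1, actPath g e.2⟩
  one_smul e := Sigma.ext rfl (heq_of_eq (actPath_one e.2))
  mul_smul g h e := Sigma.ext rfl (heq_of_eq (actPath_mul g h e.2))

/-- The characteristic map of a cell of `X̃`: the lift of the characteristic map of the cell of
`X` that takes the centre of the cube to the given point. -/
def liftedCharMap {x₀ : X} {n : ℕ} (e : LiftedCell x₀ n) (y : Cube n) : UnivCover x₀ :=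
  ⟨charMap e.1 y, e.2.trans (Path.Homotopic.Quotient.mk (charPath e.1 y))⟩

theorem liftedCharMap_smul {x₀ : X} {n : ℕ} (g : FundamentalGroup X x₀) (e : LiftedCell x₀ n)
    (y : Cube n) : liftedCharMap (g • e) y = g • liftedCharMap e y :=
  Sigma.ext rfl (heq_of_eq (Path.Homotopic.Quotient.trans_assoc _ _ _))

open Classical in
/-- The point of the cube with the property `P`, if there is one, and `∞` otherwise. -/
def pointOrInfty {n : ℕ} (P : OpenCube n → Prop) : OnePoint (OpenCube n) :=
  if h : ∃ y, P y then ((h.choose : OpenCube n) : OnePoint (OpenCube n)) else OnePoint.infty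

/-- The collapse of the complement of the open cell `e'` to a point: the inverse of the
characteristic map on the open cell `e'`, and `∞` outside it. The quotient of the `n`-skeleton by
the complement of `e'` is identified in this way with the one-point compactification of the open
cube, which is an `n`-sphere. -/
def collapse {x₀ : X} {n : ℕ} (e' : LiftedCell x₀ n) (P : UnivCover x₀) :
    OnePoint (OpenCube n) :=
  pointOrInfty fun y => liftedCharMap e' y.toCube = P

theorem collapse_smul {x₀ : X} {n : ℕ} (g : FundamentalGroup X x₀) (e' : LiftedCell x₀ n)
    (P : UnivCover x₀) : collapse (g • e') (g • P) = collapse e' P := by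
  unfold collapse
  simp only [liftedCharMap_smul, smul_left_cancel_iff]

/-- The first `n` coordinates of a point of the boundary of the `(n+1)`-cube. -/
def firstCoords {n : ℕ} (x : CubeBoundary (n + 1)) : Fin n → ℝ := fun i => x.1 i.castSucc

open Classical in
/-- The reference map of degree one from the boundary of the `(n+1)`-cube to the one-point
compactification of the open `n`-cube: the open face on which the last coordinate equals `1` is
projected to the open `n`-cube, and all the rest goes to `∞`. -/
def referenceMap (n : ℕ) (x : CubeBoundary (n + 1)) : OnePoint (OpenCube n) :=
  if h : x.1 (Fin.last n) = 1 ∧ firstCoords x ∈ Metric.ball (0 : Fin n → ℝ) 1 then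
    ((⟨firstCoords x, h.2⟩ : OpenCube n) : OnePoint (OpenCube n))
  else OnePoint.infty

theorem referenceMap_continuous (n : ℕ) : Continuous (referenceMap n) := by
  have hlast : Continuous fun z : CubeBoundary (n + 1) => z.1 (Fin.last n) :=
    (continuous_apply _).comp continuous_subtype_val
  have hinit : Continuous fun z : CubeBoundary (n + 1) => firstCoords z :=
    continuous_pi fun i => (continuous_apply _).comp continuous_subtype_val
  have hone (z : CubeBoundary (n + 1)) (h0 : 0 < z.1 (Fin.last n))
      (hb : firstCoords z ∈ Metric.ball (0 : Fin n → ℝ) 1) : z.1 (Fin.last n) = 1 := by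
    have hz := mem_sphere_zero_iff_norm.mp z.2
    rw [mem_ball_zero_iff] at hb
    by_contra hne
    have hle := (norm_le_pi_norm z.1 (Fin.last n)).trans_eq hz
    rw [Real.norm_of_nonneg h0.le] at hle
    have : ‖z.1‖ < 1 := by
      rw [pi_norm_lt_iff one_pos]
      intro i
      induction i using Fin.lastCases with
      | last => rw [Real.norm_of_nonneg h0.le]; exact lt_of_le_of_ne hle hne
      | cast i => exact (norm_le_pi_norm (firstCoords z) i).trans_lt hb
    exact absurd hz this.ne
  rw [continuous_def]
  intro U hU
  rw [OnePoint.isOpen_def] at hU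
  by_cases hU' : OnePoint.infty ∈ U
  · have hK : IsCompact ((↑) ⁻¹' U : Set (OpenCube n))ᶜ := hU.1 hU'
    have hK' := hK.image continuous_subtype_val
    have : referenceMap n ⁻¹' U =
        ({z | z.1 (Fin.last n) = 1} ∩ {z | firstCoords z ∈
          (Subtype.val '' ((↑) ⁻¹' U : Set (OpenCube n))ᶜ : Set (Fin n → ℝ))})ᶜ := by
      ext z
      by_cases h : z.1 (Fin.last n) = 1 ∧ firstCoords z ∈ Metric.ball (0 : Fin n → ℝ) 1
      · simp only [Set.mem_preimage, referenceMap, dif_pos h, Set.mem_compl_iff, Set.mem_inter_iff,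
          Set.mem_ofPred_eq, h.1, true_and, Set.mem_image, Subtype.exists, exists_and_right,
          exists_eq_right, not_exists, not_not]
        exact ⟨fun hz _ => hz, fun hz => hz h.2⟩
      · simp only [Set.mem_preimage, referenceMap, dif_neg h, hU', Set.mem_compl_iff,
          Set.mem_inter_iff, Set.mem_ofPred_eq, true_iff]
        rintro ⟨h1, y, -, hy⟩
        exact h ⟨h1, hy ▸ y.2⟩
    rw [this, isOpen_compl_iff]
    exact (isClosed_eq hlast continuous_const).inter (hK'.isClosed.preimage hinit)
  · have : referenceMap n ⁻¹' U = {z | 0 < z.1 (Fin.last n)} ∩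
        {z | firstCoords z ∈ (Subtype.val '' ((↑) ⁻¹' U : Set (OpenCube n)) : Set (Fin n → ℝ))} := by
      ext z
      by_cases h : z.1 (Fin.last n) = 1 ∧ firstCoords z ∈ Metric.ball (0 : Fin n → ℝ) 1
      · simp only [Set.mem_preimage, referenceMap, dif_pos h, Set.mem_inter_iff,
          Set.mem_ofPred_eq, h.1, zero_lt_one, true_and, Set.mem_image, Subtype.exists,
          exists_and_right, exists_eq_right]
        exact ⟨fun hz => ⟨h.2, hz⟩, fun hz => hz.2⟩
      · simp only [Set.mem_preimage, referenceMap, dif_neg h, hU', false_iff,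
          Set.mem_inter_iff, Set.mem_ofPred_eq]
        rintro ⟨h1, y, -, hy⟩
        have hb : firstCoords z ∈ Metric.ball (0 : Fin n → ℝ) 1 := hy ▸ y.2
        exact h ⟨hone z h1 hb, hb⟩
    rw [this]
    exact (isOpen_lt continuous_const hlast).inter
      ((Metric.isOpen_ball.isOpenMap_subtype_val _ hU.2).preimage hinit)

/-- The map induced in integral singular homology of degree `n`. -/
abbrev homologyMap {Y Z : Type} [TopologicalSpace Y] [TopologicalSpace Z] (n : ℕ) (f : C(Y, Z)) :=
  ((AlgebraicTopology.singularHomologyFunctor (ModuleCat.{0} ℤ) n).obj (ModuleCat.of ℤ ℤ)).map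
    (TopCat.ofHom f)

/-- The property that `d` is the degree of the continuous map `f` from the boundary of the
`(n+1)`-cube to the one-point compactification of the open `n`-cube (both are `n`-spheres, and
`n ≥ 1` is meant): in `n`-th homology `f` induces `d` times the map induced by the reference
map. -/
def HasDegree (n : ℕ) (f : CubeBoundary (n + 1) → OnePoint (OpenCube n)) (d : ℤ) : Prop :=
  ∃ hf : Continuous f,
    homologyMap n ⟨f, hf⟩ = d • homologyMap n ⟨referenceMap n, referenceMap_continuous n⟩

open Classical in
/-- The degree of a continuous map (for `n ≥ 1` it exists and is unique). -/
def degree (n : ℕ) (f : CubeBoundary (n + 1) → OnePoint (OpenCube n)) : ℤ :=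
  if h : ∃ d, HasDegree n f d then h.choose else 0

/-- The attaching map of the cell `e` followed by the collapse of the complement of `e'`. -/
def attachCollapse {x₀ : X} {n : ℕ} (e : LiftedCell x₀ (n + 1)) (e' : LiftedCell x₀ n) :
    CubeBoundary (n + 1) → OnePoint (OpenCube n) :=
  fun s => collapse e' (liftedCharMap e s.toCube)

open Classical in
/-- The incidence number `[e : e']` of an `(n+1)`-cell and an `n`-cell of `X̃`. For `n ≥ 1` it is
the degree of the attaching map of `e` followed by the collapse of the complement of `e'`. For
`n = 0` the cell `e` is a path in `X̃`, and `[e : e']` is `1` for its end point minus `1` for its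
starting point. -/
def incidence {x₀ : X} : ∀ {n : ℕ}, LiftedCell x₀ (n + 1) → LiftedCell x₀ n → ℤ
  | 0, e, e' =>
      (if liftedCharMap e ⟨fun _ => 1, by simp⟩ =
        liftedCharMap e' ⟨0, by simp⟩ then 1 else 0) -
      (if liftedCharMap e ⟨fun _ => -1, by simp⟩ =
        liftedCharMap e' ⟨0, by simp⟩ then 1 else 0)
  | n + 1, e, e' => degree (n + 1) (attachCollapse e e')

theorem incidence_smul {x₀ : X} {n : ℕ} (g : FundamentalGroup X x₀) (e : LiftedCell x₀ (n + 1))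
    (e' : LiftedCell x₀ n) : incidence (g • e) (g • e') = incidence e e' := by
  cases n with
  | zero =>
    have h (y : Cube 1) (z : Cube 0) :
        liftedCharMap (g • e) y = liftedCharMap (g • e') z ↔
          liftedCharMap e y = liftedCharMap e' z := by
      rw [liftedCharMap_smul, liftedCharMap_smul, smul_left_cancel_iff]
    classical
    exact congrArg₂ (fun a b : ℤ => a - b) (if_congr (h _ _) rfl rfl) (if_congr (h _ _) rfl rfl)
  | succ n =>
    have h : attachCollapse (g • e) (g • e') = attachCollapse e e' := by
      funext s
      simp only [attachCollapse, liftedCharMap_smul, collapse_smul]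
    simp only [incidence, h]

/-- The cellular chain group `C_n(X̃)`. -/
abbrev Chains (x₀ : X) (n : ℕ) : Type _ := LiftedCell x₀ n →₀ ℤ

/-- The left action of the fundamental group on `C_n(X̃)`. -/
def deck {x₀ : X} {n : ℕ} (g : FundamentalGroup X x₀) : Chains x₀ n →ₗ[ℤ] Chains x₀ n :=
  Finsupp.lmapDomain ℤ ℤ (fun e => g • e)

/-- The cellular boundary of an `(n+1)`-cell of `X̃`, the sum of all `[e : e'] e'`. Only finitely
many `e'` contribute, since the attaching sphere is compact. -/
def cellBoundary {x₀ : X} {n : ℕ} (e : LiftedCell x₀ (n + 1)) : Chains x₀ n :=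
  ∑ᶠ e' : LiftedCell x₀ n, Finsupp.single e' (incidence e e')

theorem cellBoundary_smul {x₀ : X} {n : ℕ} (g : FundamentalGroup X x₀)
    (e : LiftedCell x₀ (n + 1)) : cellBoundary (g • e) = deck g (cellBoundary e) := by
  unfold cellBoundary
  have hinj : Function.Injective (deck (x₀ := x₀) (n := n) g) :=
    Finsupp.mapDomain_injective (MulAction.injective g)
  have h := (deck (x₀ := x₀) (n := n) g).toAddMonoidHom.map_finsum_of_injective hinj
    (fun e' => Finsupp.single e' (incidence e e'))
  simp only [LinearMap.toAddMonoidHom_coe] at h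
  rw [h, ← finsum_comp_equiv (MulAction.toPerm g)]
  refine finsum_congr fun e' => ?_
  simp [deck, incidence_smul]

/-- The boundary operator `C_k(X̃) → C_{k-1}(X̃)` (zero for `k = 0`). -/
def boundary (x₀ : X) : ∀ k : ℕ, Chains x₀ k →ₗ[ℤ] Chains x₀ (k - 1)
  | 0 => 0
  | n + 1 => Finsupp.linearCombination ℤ (cellBoundary (x₀ := x₀) (n := n))

theorem boundary_deck {x₀ : X} (k : ℕ) (g : FundamentalGroup X x₀) (c : Chains x₀ k) :
    boundary x₀ k (deck g c) = deck g (boundary x₀ k c) := by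
  cases k with
  | zero => simp [boundary]
  | succ n =>
    induction c using Finsupp.induction_linear with
    | zero => simp
    | add c d hc hd => simp only [map_add, hc, hd]
    | single e a =>
      have h : deck g (Finsupp.single e a) = Finsupp.single (g • e) a := by simp [deck]
      rw [h]
      simp only [boundary, Finsupp.linearCombination_single, cellBoundary_smul, map_smul]

end UniversalCover

/-! ## Homology and cohomology with twisted coefficients -/

section Twisted

open Topology

variable {X : Type*} [TopologicalSpace X] [CWComplex (Set.univ : Set X)] {x₀ : X}
variable {B : Type*} [CommRing B] {l : ℕ}

/-- The relations of the tensor product `C_k(X̃) ⊗_σ B^l` over the group ring, where `C_k(X̃)` is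
a right module through `x · g = g⁻¹ x`: they are `(x · g) ⊗ v = x ⊗ σ(g) v`. -/
def tensorRelations (σ : FundamentalGroup X x₀ →* GL (Fin l) B) (k : ℕ) :
    Submodule B ((Fin l → B) ⊗[ℤ] Chains x₀ k) :=
  Submodule.span B {z | ∃ (g : FundamentalGroup X x₀) (v : Fin l → B) (x : Chains x₀ k),
    z = v ⊗ₜ[ℤ] deck g⁻¹ x - ((σ g).1 *ᵥ v) ⊗ₜ[ℤ] x}

/-- The twisted chain group `C_k(X̃) ⊗_σ B^l`. -/
abbrev TwChains (σ : FundamentalGroup X x₀ →* GL (Fin l) B) (k : ℕ) : Type _ :=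
  ((Fin l → B) ⊗[ℤ] Chains x₀ k) ⧸ tensorRelations σ k

/-- The boundary operator `∂ ⊗ id` of the twisted chain complex. -/
def twBoundary (σ : FundamentalGroup X x₀ →* GL (Fin l) B) (k : ℕ) :
    TwChains σ k →ₗ[B] TwChains σ (k - 1) :=
  Submodule.mapQ _ _ (TensorProduct.AlgebraTensorModule.lTensor B (Fin l → B) (boundary x₀ k)) <| by
    rw [tensorRelations, Submodule.span_le]
    rintro _ ⟨g, v, x, rfl⟩
    refine Submodule.subset_span ⟨g, v, boundary x₀ k x, ?_⟩
    simp [boundary_deck]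

/-- The homology `H_k(C_*(X̃) ⊗_σ B^l)`: cycles modulo boundaries. -/
abbrev TwHomology (σ : FundamentalGroup X x₀ →* GL (Fin l) B) (k : ℕ) : Type _ :=
  LinearMap.ker (twBoundary σ k) ⧸
    (LinearMap.range (twBoundary σ (k + 1))).comap (LinearMap.ker (twBoundary σ k)).subtype

/-- The twisted cochain group `Hom_G(C_k(X̃), B^l)`. -/
def TwCochains (σ : FundamentalGroup X x₀ →* GL (Fin l) B) (k : ℕ) :
    Submodule B (Chains x₀ k →ₗ[ℤ] (Fin l → B)) where
  carrier := {c | ∀ g x, c (deck g x) = (σ g).1 *ᵥ c x}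
  add_mem' := by
    intro c d hc hd g x
    simp [hc g x, hd g x, Matrix.mulVec_add]
  zero_mem' := by
    intro g x
    simp
  smul_mem' := by
    intro b c hc g x
    simp [hc g x, Matrix.mulVec_smul]

instance (σ : FundamentalGroup X x₀ →* GL (Fin l) B) (k : ℕ) : AddCommGroup (TwCochains σ k) :=
  Submodule.addCommGroup _

/-- The coboundary operator `Hom_G(C_{k-1}(X̃), B^l) → Hom_G(C_k(X̃), B^l)`, `c ↦ c ∘ ∂`. -/
def twCoboundary (σ : FundamentalGroup X x₀ →* GL (Fin l) B) (k : ℕ) :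
    TwCochains σ (k - 1) →ₗ[B] TwCochains σ k where
  toFun c := ⟨c.1 ∘ₗ boundary x₀ k, fun g x => by
    simp only [LinearMap.comp_apply, boundary_deck]
    exact c.2 g _⟩
  map_add' _ _ := rfl
  map_smul' _ _ := rfl

/-- The cocycles of degree `k`. -/
def twCocycles (σ : FundamentalGroup X x₀ →* GL (Fin l) B) (k : ℕ) :
    Submodule B (TwCochains σ k) :=
  LinearMap.ker (twCoboundary σ (k + 1))

/-- The cohomology `H^k(X, σ) = H^k(Hom_G(C_*(X̃), B^l))`: cocycles modulo coboundaries. -/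
abbrev TwCohomology (σ : FundamentalGroup X x₀ →* GL (Fin l) B) (k : ℕ) : Type _ :=
  twCocycles σ k ⧸ (LinearMap.range (twCoboundary σ k)).comap (twCocycles σ k).subtype

/-- The homological Betti number of `X` with respect to `σ`: the rank of `H_k(X, σ)`, that is, the
dimension of its localization over the fraction field of the integral domain `B`. -/
def bettiHomology (σ : FundamentalGroup X x₀ →* GL (Fin l) B) (k : ℕ) : ℕ :=
  Module.finrank (FractionRing B) (FractionRing B ⊗[B] TwHomology σ k)

/-- The cohomological Betti number of `X` with respect to `σ`: the dimension of the localization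
of `H^k(X, σ)` over the fraction field of the integral domain `B`. -/
def bettiCohomology (σ : FundamentalGroup X x₀ →* GL (Fin l) B) (k : ℕ) : ℕ :=
  Module.finrank (FractionRing B) (FractionRing B ⊗[B] TwCohomology σ k)

end Twisted

/-! ## Deformations of a representation -/

section Deformations

variable {G : Type*} [Group G] {l : ℕ}

/-- The tensor product of a representation over `R` with a character with values in the units of
an `R`-algebra `S`. -/
def twist {R S : Type*} [CommRing R] [CommRing S] [Algebra R S] (ρ : G →* GL (Fin l) R)
    (χ : G →* Sˣ) : G →* GL (Fin l) S where
  toFun g := Units.map (Matrix.scalar (Fin l) : S →+* Matrix (Fin l) (Fin l) S).toMonoidHom (χ g) *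
    Matrix.GeneralLinearGroup.map (algebraMap R S) (ρ g)
  map_one' := by simp
  map_mul' g h := by
    ext1
    have h1 := Matrix.scalar_commute (n := Fin l) (χ h : S) (fun _ => Commute.all _ _)
      ((ρ g).1.map (algebraMap R S))
    simp only [map_mul, mul_assoc]
    simp only [Units.val_mul]
    congr 1
    simp only [← mul_assoc]
    congr 1

/-- The contragredient representation `g ↦ ᵗρ(g)⁻¹`. -/
def contragredient {R : Type*} [CommRing R] (ρ : G →* GL (Fin l) R) : G →* GL (Fin l) R where
  toFun g := ⟨((ρ g)⁻¹).1ᵀ, (ρ g).1ᵀ, by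
    rw [← Matrix.transpose_mul]; simp, by
    rw [← Matrix.transpose_mul]; simp⟩
  map_one' := by
    ext1
    simp
  map_mul' g h := by
    ext1
    simp [Matrix.transpose_mul]

/-- The exponential deformation `γ_t(g) = e^{t⟨α,g⟩} ρ(g)`. -/
def expDeformation (ρ : G →* GL (Fin l) ℂ) (α : Additive G →+ ℂ) (t : ℂ) : G →* GL (Fin l) ℂ :=
  twist ρ (MonoidHom.toHomUnits
    { toFun := fun g => Complex.exp (t * α (Additive.ofMul g))
      map_one' := by simp
      map_mul' := fun g h => by simp [mul_add, Complex.exp_add] })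

/-- The formal power series `e^{ta}`. -/
def formalExp (a : ℂ) : PowerSeries ℂ := PowerSeries.rescale a (PowerSeries.exp ℂ)

/-- The formal exponential deformation `γ̂(g) = e^{t⟨α,g⟩} ρ(g)`, a representation over `ℂ[[t]]`. -/
def formalDeformation (ρ : G →* GL (Fin l) ℂ) (α : Additive G →+ ℂ) :
    G →* GL (Fin l) (PowerSeries ℂ) :=
  twist ρ (MonoidHom.toHomUnits
    { toFun := fun g => formalExp (α (Additive.ofMul g))
      map_one' := by
        ext n
        rcases n with _ | n <;> simp [formalExp, PowerSeries.coeff_one]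
      map_mul' := fun g h => by
        simp [formalExp, PowerSeries.exp_mul_exp_eq_exp_add] })

/-- The ring `L_m = R[ℤ^m]` of Laurent polynomials in `m` variables. -/
abbrev Laurent (R : Type*) [CommRing R] (m : ℕ) : Type _ := AddMonoidAlgebra R (Fin m → ℤ)

/-- The tensor product of the representation `ρ` and of a homomorphism `q : G → ℤ^m`, regarded as
a representation over `L_m`. -/
def laurentRep {R : Type*} [CommRing R] {m : ℕ} (ρ : G →* GL (Fin l) R)
    (q : G →* Multiplicative (Fin m → ℤ)) : G →* GL (Fin l) (Laurent R m) :=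
  twist ρ (MonoidHom.toHomUnits ((AddMonoidAlgebra.of R (Fin m → ℤ)).comp q))

/-! ## The Novikov ring -/

/-- The group `ℤ^m`, with the partial order in which `a < b` means `η b < η a`. -/
def NovExp {m : ℕ} (_η : (Fin m → ℤ) →+ ℝ) : Type := Fin m → ℤ

instance {m : ℕ} (η : (Fin m → ℤ) →+ ℝ) : AddCommGroup (NovExp η) :=
  inferInstanceAs (AddCommGroup (Fin m → ℤ))

/-- The value of `η` at an exponent. -/
def NovExp.height {m : ℕ} {η : (Fin m → ℤ) →+ ℝ} : NovExp η →+ ℝ := η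

instance {m : ℕ} (η : (Fin m → ℤ) →+ ℝ) : PartialOrder (NovExp η) where
  le a b := a = b ∨ b.height < a.height
  le_refl a := Or.inl rfl
  le_trans a b c := by
    rintro (rfl | h) (rfl | h')
    · exact Or.inl rfl
    · exact Or.inr h'
    · exact Or.inr h
    · exact Or.inr (h'.trans h)
  le_antisymm a b := by
    rintro (rfl | h) (h' | h')
    · rfl
    · rfl
    · exact h'.symm
    · exact absurd h (not_lt.mpr h'.le)

theorem NovExp.le_def {m : ℕ} {η : (Fin m → ℤ) →+ ℝ} (a b : NovExp η) :
    a ≤ b ↔ a = b ∨ b.height < a.height := Iff.rfl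

instance {m : ℕ} (η : (Fin m → ℤ) →+ ℝ) : IsOrderedCancelAddMonoid (NovExp η) where
  add_le_add_left a b h c := by
    rw [NovExp.le_def] at h ⊢
    rcases h with rfl | h
    · exact Or.inl rfl
    · right; simpa using h
  le_of_add_le_add_left a b c h := by
    rw [NovExp.le_def] at h ⊢
    rcases h with h | h
    · exact Or.inl (add_left_cancel h)
    · right; simpa using h

/-- A set of exponents that is finite in the direction of `η`. -/
def NovFinite {m : ℕ} {η : (Fin m → ℤ) →+ ℝ} (s : Set (NovExp η)) : Prop :=
  ∀ C : ℝ, {a | a ∈ s ∧ C ≤ a.height}.Finite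

theorem NovFinite.mono {m : ℕ} {η : (Fin m → ℤ) →+ ℝ} {s t : Set (NovExp η)} (hst : s ⊆ t)
    (ht : NovFinite t) : NovFinite s :=
  fun C => (ht C).subset fun _ ha => ⟨hst ha.1, ha.2⟩

theorem NovFinite.union {m : ℕ} {η : (Fin m → ℤ) →+ ℝ} {s t : Set (NovExp η)}
    (hs : NovFinite s) (ht : NovFinite t) : NovFinite (s ∪ t) := by
  intro C
  refine ((hs C).union (ht C)).subset ?_
  rintro a ⟨ha | ha, hC⟩
  · exact Or.inl ⟨ha, hC⟩
  · exact Or.inr ⟨ha, hC⟩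

theorem NovFinite.of_finite {m : ℕ} {η : (Fin m → ℤ) →+ ℝ} {s : Set (NovExp η)}
    (hs : s.Finite) : NovFinite s :=
  fun _ => hs.subset fun _ ha => ha.1

theorem NovFinite.bddAbove {m : ℕ} {η : (Fin m → ℤ) →+ ℝ} {s : Set (NovExp η)}
    (hs : NovFinite s) : ∃ M : ℝ, ∀ a ∈ s, a.height ≤ M := by
  obtain ⟨M, hM⟩ := ((hs 0).image NovExp.height).bddAbove
  refine ⟨max M 0, fun a ha => ?_⟩
  by_cases h : 0 ≤ a.height
  · exact (hM ⟨a, ⟨ha, h⟩, rfl⟩).trans (le_max_left _ _)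
  · exact (not_le.mp h).le.trans (le_max_right _ _)

open scoped Pointwise in
theorem NovFinite.add {m : ℕ} {η : (Fin m → ℤ) →+ ℝ} {s t : Set (NovExp η)}
    (hs : NovFinite s) (ht : NovFinite t) : NovFinite (s + t) := by
  intro C
  obtain ⟨M, hM⟩ := hs.bddAbove
  obtain ⟨N, hN⟩ := ht.bddAbove
  refine ((hs (C - N)).add (ht (C - M))).subset ?_
  rintro _ ⟨⟨a, ha, b, hb, rfl⟩, hC⟩
  simp only [map_add] at hC
  exact ⟨a, ⟨ha, by linarith [hN b hb]⟩, b, ⟨hb, by linarith [hM a ha]⟩, rfl⟩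

theorem NovFinite.isPWO {m : ℕ} {η : (Fin m → ℤ) →+ ℝ} {s : Set (NovExp η)}
    (hs : NovFinite s) : s.IsPWO := by
  refine Set.partiallyWellOrderedOn_iff_exists_lt.mpr fun f hf => ?_
  by_cases h : ∃ n, 0 < n ∧ (f n).height < (f 0).height
  · obtain ⟨n, hn, hlt⟩ := h
    exact ⟨0, n, hn, Or.inr hlt⟩
  · push Not at h
    have hfin := hs (f 0).height
    have hmem : ∀ n, f n ∈ {a | a ∈ s ∧ (f 0).height ≤ a.height} := by
      intro n
      refine ⟨hf n, ?_⟩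
      rcases Nat.eq_zero_or_pos n with rfl | hn
      · exact le_rfl
      · exact h n hn
    obtain ⟨a, b, hab, he⟩ := hfin.exists_lt_map_eq_of_forall_mem hmem
    exact ⟨a, b, hab, Or.inl he⟩

/-- The Novikov completion of `L_m = R[ℤ^m]` with respect to `η`: the formal series
`∑ n_a a` (`a ∈ ℤ^m`, `n_a ∈ R`) such that for every real `C` only finitely many `a` in the support
have `η a ≥ C`, with the convolution product. The finiteness condition implies that the support is
partially well ordered for the order of `NovExp η`, so that all these series occur among the Hahn
series, whose product is the convolution product. -/
def NovikovRing (R : Type*) [CommRing R] {m : ℕ} (η : (Fin m → ℤ) →+ ℝ) :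
    Subring (HahnSeries (NovExp η) R) where
  carrier := {f | NovFinite f.support}
  mul_mem' hf hg := (hf.add hg).mono HahnSeries.support_mul_subset
  one_mem' := NovFinite.of_finite ((Set.finite_singleton 0).subset HahnSeries.support_single_subset)
  add_mem' hf hg := (hf.union hg).mono (HahnSeries.support_add_subset _ _)
  zero_mem' := NovFinite.of_finite (by simp)
  neg_mem' hf := hf.mono (HahnSeries.support_neg_subset _)

/-- The series with the given coefficients. -/
def NovikovRing.ofFun {R : Type*} [CommRing R] {m : ℕ} {η : (Fin m → ℤ) →+ ℝ} (f : NovExp η → R)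
    (hf : NovFinite (Function.support f)) : NovikovRing R η :=
  ⟨⟨f, hf.isPWO⟩, hf⟩

/-- The monomial `r a`. -/
def NovikovRing.monomial {R : Type*} [CommRing R] {m : ℕ} {η : (Fin m → ℤ) →+ ℝ} (a : NovExp η)
    (r : R) : NovikovRing R η :=
  ⟨HahnSeries.single a r,
    NovFinite.of_finite ((Set.finite_singleton a).subset HahnSeries.support_single_subset)⟩

/-- The inclusion of the ring of Laurent polynomials into its Novikov completion. -/
def laurentToNovikov (R : Type*) [CommRing R] {m : ℕ} (η : (Fin m → ℤ) →+ ℝ) :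
    Laurent R m →+* NovikovRing R η :=
  AddMonoidAlgebra.liftNCRingHom
    ({ toFun := fun r => NovikovRing.monomial 0 r
       map_one' := rfl
       map_zero' := by ext1; simp [NovikovRing.monomial]
       map_add' := fun r s => by ext1; simp [NovikovRing.monomial]
       map_mul' := fun r s => by ext1; simp [NovikovRing.monomial] } : R →+* NovikovRing R η)
    ({ toFun := fun a => NovikovRing.monomial (η := η) a.toAdd 1
       map_one' := rfl
       map_mul' := fun a b => by
         ext1
         refine Eq.trans ?_ HahnSeries.single_mul_single.symm
         rw [mul_one]
         rfl } :
      Multiplicative (Fin m → ℤ) →* NovikovRing R η)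
    (fun _ _ => Commute.all _ _)

end Deformations

/-! ## The Betti numbers of the Laurent and Novikov complexes -/

section Numbers

open Topology

variable {X : Type*} [TopologicalSpace X]

/-- The group `H_1(X, ℤ)/Tors`, where `H_1(X, ℤ)` is the abelianized fundamental group. -/
abbrev H1Free (x₀ : X) : Type _ :=
  Abelianization (FundamentalGroup X x₀) ⧸
    CommGroup.torsion (Abelianization (FundamentalGroup X x₀))

/-- The projection `φ : G → H_1(X, ℤ)/Tors ≅ ℤ^n`. -/
def freeProj {x₀ : X} {n : ℕ} (θ : H1Free x₀ ≃* Multiplicative (Fin n → ℤ)) :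
    FundamentalGroup X x₀ →* Multiplicative (Fin n → ℤ) :=
  θ.toMonoidHom.comp ((QuotientGroup.mk' _).comp Abelianization.of)

/-- The irrationality degree of a class `α ∈ H^1(X, ℂ) = Hom(G, ℂ)`: the rank of the group of its
values. -/
def irr {G : Type*} [Group G] (α : Additive G →+ ℂ) : ℕ := Module.finrank ℤ α.range

variable [CWComplex (Set.univ : Set X)] {x₀ : X} {R : Type*} [CommRing R] {l n m : ℕ}

/-- The representation `ρ_p = ρ ⊗ (p ∘ φ)` over `L_m`. -/
def repP (ρ : FundamentalGroup X x₀ →* GL (Fin l) R)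
    (θ : H1Free x₀ ≃* Multiplicative (Fin n → ℤ)) (p : (Fin n → ℤ) →+ (Fin m → ℤ)) :
    FundamentalGroup X x₀ →* GL (Fin l) (Laurent R m) :=
  laurentRep ρ (p.toMultiplicative.comp (freeProj θ))

/-- The number `b_k(X, ρ; p)`: the dimension over the field of fractions `{L_m}` of
`H_k(C_*(X̃) ⊗_{ρ_p} {L_m}^l)`. -/
def bettiLaurent (ρ : FundamentalGroup X x₀ →* GL (Fin l) R)
    (θ : H1Free x₀ ≃* Multiplicative (Fin n → ℤ)) (p : (Fin n → ℤ) →+ (Fin m → ℤ)) (k : ℕ) : ℕ :=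
  Module.finrank (FractionRing (Laurent R m))
    (TwHomology ((Matrix.GeneralLinearGroup.map
      (algebraMap (Laurent R m) (FractionRing (Laurent R m)))).comp (repP ρ θ p)) k)

/-- The twisted Novikov Betti number: the rank of the module `H_k(C_*(X̃) ⊗_{ρ_p} L̂^l)` over the
Novikov completion `L̂` of `L_m` with respect to `η`. -/
def novikovBetti (ρ : FundamentalGroup X x₀ →* GL (Fin l) R)
    (θ : H1Free x₀ ≃* Multiplicative (Fin n → ℤ)) (p : (Fin n → ℤ) →+ (Fin m → ℤ))
    (η : (Fin m → ℤ) →+ ℝ) (k : ℕ) : ℕ :=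
  bettiHomology ((Matrix.GeneralLinearGroup.map (laurentToNovikov R η)).comp (repP ρ θ p)) k

end Numbers

end ExpDeform

end

/-!
Over an integral domain, a ring homomorphism can only lower the rank of a matrix, and it preserves
the rank as soon as one fixed nonzero maximal minor has a nonzero image. In the bases given by
representatives of the orbits of cells, the twisted Betti numbers are determined by the ranks of the
boundary matrices and of their product. Hence for each `σ` over `B` there is a nonzero `b : B` such
that every homomorphism `f` of integral domains with `f b ≠ 0` preserves the `k`-th Betti number; in
particular every injective `f` does. In cohomology, the coboundary matrices of `σ` are the
transposes of the boundary matrices of the contragredient representation.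

The deformations and the Novikov complex all arise from `ρ_p` over `L_m` by change of rings. The map
`L_m → ℂ[[t]]`, `a ↦ e^{t α̃(a)}`, is injective by the linear independence of characters, and so is
the inclusion of `L_m` into the Novikov ring, which is an integral domain because an injective `α̃`
orders `ℤ^m` linearly. For numerical `t`, the image of `b` under `a ↦ e^{t α̃(a)}` is an entire
function of `t`; it is not identically zero, again by the independence of characters, so its zeros
form a closed discrete set.
-/

noncomputable section

namespace ExpDeform

/-! ## Ranks of matrices over an integral domain -/

section MatrixRank

variable {I J : Type*} [Fintype J]

theorem exists_linearIndependent_submatrix_col {K : Type*} [Field K] (A : Matrix I J K) :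
    ∃ c : Fin A.rank → J, LinearIndependent K (A.submatrix id c).col := by
  have := Module.Finite.span_of_finite K (Set.finite_range A.col)
  rw [Matrix.rank_eq_finrank_span_cols]
  obtain ⟨f, hf, -, hli⟩ := Submodule.exists_fun_fin_finrank_span_eq K (Set.range A.col)
  choose c hc using hf
  have hcol : (A.submatrix id c).col = f := funext hc
  exact ⟨c, hcol ▸ hli⟩

theorem rank_map_algebraMap_of_isFractionRing [Finite I] {B : Type*} (K : Type*) [CommRing B]
    [Field K] [Algebra B K] [IsFractionRing B K] (A : Matrix I J B) :
    (A.map (algebraMap B K)).rank = A.rank := by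
  let ι : (I → B) →ₗ[B] (I → K) := .pi fun i => Algebra.linearMap B K ∘ₗ .proj i
  have hcols : Set.range (A.map (algebraMap B K)).col = ι '' Set.range A.col := by
    rw [← Set.range_comp]
    rfl
  rw [Matrix.rank_eq_finrank_span_cols, Matrix.rank_eq_finrank_span_cols, hcols,
    ← Submodule.localized'_span K (nonZeroDivisors B) ι, IsFractionRing.finrank_right_eq B K]
  exact IsLocalizedModule.finrank_eq (nonZeroDivisors B)
    ((Submodule.span B (Set.range A.col)).toLocalized' K (nonZeroDivisors B) ι) le_rfl

theorem rank_transpose_of_isDomain [Fintype I] {B : Type*} [CommRing B] [IsDomain B]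
    (A : Matrix I J B) : Aᵀ.rank = A.rank := by
  rw [← rank_map_algebraMap_of_isFractionRing (FractionRing B) A,
    ← rank_map_algebraMap_of_isFractionRing (FractionRing B) Aᵀ, Matrix.transpose_map,
    Matrix.rank_transpose]

theorem det_submatrix_map {B C : Type*} [CommRing B] [CommRing C] {r : Type*} [Fintype r]
    [DecidableEq r] {I J : Type*} (f : B →+* C) (A : Matrix I J B) (s : r → I) (c : r → J) :
    ((A.map f).submatrix s c).det = f (A.submatrix s c).det := by
  rw [Matrix.submatrix_map, ← RingHom.mapMatrix_apply, ← RingHom.map_det]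

theorem le_rank_of_submatrix_det_ne_zero {B : Type*} [CommRing B] [IsDomain B] (A : Matrix I J B)
    {r : ℕ} (s : Fin r → I) (c : Fin r → J) (h : (A.submatrix s c).det ≠ 0) : r ≤ A.rank := by
  have := A.rank_submatrix_le s c
  rwa [Matrix.rank_of_det_ne_zero h, Fintype.card_fin] at this

variable [Finite I]

theorem exists_submatrix_det_ne_zero_of_field {K : Type*} [Field K] (A : Matrix I J K) :
    ∃ (s : Fin A.rank → I) (c : Fin A.rank → J), (A.submatrix s c).det ≠ 0 := by
  have := Fintype.ofFinite I
  obtain ⟨c, hc⟩ := exists_linearIndependent_submatrix_col A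
  have hrank : (A.submatrix id c)ᵀ.rank = A.rank := by
    rw [LinearIndependent.rank_matrix hc, Fintype.card_fin]
  have hs := exists_linearIndependent_submatrix_col (A.submatrix id c)ᵀ
  rw [hrank] at hs
  obtain ⟨s, hs⟩ := hs
  have hunit : IsUnit (A.submatrix s c) := Matrix.linearIndependent_rows_iff_isUnit.mp hs
  exact ⟨s, c, ((Matrix.isUnit_iff_isUnit_det _).mp hunit).ne_zero⟩

theorem exists_submatrix_det_ne_zero {B : Type*} [CommRing B] [IsDomain B] (A : Matrix I J B) :
    ∃ (s : Fin A.rank → I) (c : Fin A.rank → J), (A.submatrix s c).det ≠ 0 := by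
  have h := exists_submatrix_det_ne_zero_of_field (A.map (algebraMap B (FractionRing B)))
  rw [rank_map_algebraMap_of_isFractionRing] at h
  obtain ⟨s, c, hdet⟩ := h
  rw [det_submatrix_map] at hdet
  exact ⟨s, c, ne_zero_of_map hdet⟩

theorem rank_map_le {B C : Type*} [CommRing B] [IsDomain B] [CommRing C] [IsDomain C]
    (f : B →+* C) (A : Matrix I J B) : (A.map f).rank ≤ A.rank := by
  obtain ⟨s, c, h⟩ := exists_submatrix_det_ne_zero (A.map f)
  rw [det_submatrix_map] at h
  exact le_rank_of_submatrix_det_ne_zero A s c (ne_zero_of_map h)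

theorem exists_ne_zero_rank_map_eq {B : Type*} [CommRing B] [IsDomain B] (A : Matrix I J B) :
    ∃ b : B, b ≠ 0 ∧ ∀ {C : Type*} [CommRing C] [IsDomain C] (f : B →+* C), f b ≠ 0 →
      (A.map f).rank = A.rank := by
  obtain ⟨s, c, h⟩ := exists_submatrix_det_ne_zero A
  refine ⟨_, h, fun f hf => (rank_map_le f A).antisymm ?_⟩
  exact le_rank_of_submatrix_det_ne_zero _ s c ((det_submatrix_map f A s c).trans_ne hf)

end MatrixRank

section HomologyRank

universe u

variable {B : Type*} [CommRing B]

theorem finrank_fractionRing_tensorProduct {M : Type*} [AddCommGroup M] [Module B M] :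
    Module.finrank (FractionRing B) (FractionRing B ⊗[B] M) = Module.finrank B M := by
  rw [IsFractionRing.finrank_right_eq B (FractionRing B)]
  exact IsLocalizedModule.finrank_eq (nonZeroDivisors B) (TensorProduct.mk B (FractionRing B) M 1)
    le_rfl

theorem finrank_range_eq_rank_toMatrix {I J V W : Type*} [Finite I] [Fintype J] [DecidableEq J]
    [AddCommGroup V] [Module B V] [AddCommGroup W] [Module B W]
    (b : Module.Basis J B V) (c : Module.Basis I B W) (f : V →ₗ[B] W) :
    Module.finrank B (LinearMap.range f) = (LinearMap.toMatrix b c f).rank := by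
  have := Fintype.ofFinite I
  rw [Matrix.rank_eq_finrank_range_toLin _ c b, Matrix.toLin_toMatrix]

theorem rank_comap_subtype_comm {V : Type*} [AddCommGroup V] [Module B V] (M N : Submodule B V) :
    Module.rank B (N.comap M.subtype) = Module.rank B (M.comap N.subtype) := by
  rw [(M.equivSubtypeMap _).rank_eq, (N.equivSubtypeMap _).rank_eq, Submodule.map_comap_subtype,
    Submodule.map_comap_subtype, inf_comm]

variable [IsDomain B]

-- The term of `f ∘ₗ g` vanishes on a complex; keeping it spares a proof of `∂ ∘ ∂ = 0` for the
-- cellular boundary.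
theorem rank_homology_add_rank_range_add_rank_range {U V W : Type u} [AddCommGroup U] [Module B U]
    [AddCommGroup V] [Module B V] [AddCommGroup W] [Module B W] (g : U →ₗ[B] V) (f : V →ₗ[B] W) :
    Module.rank B (LinearMap.ker f ⧸ (LinearMap.range g).comap (LinearMap.ker f).subtype) +
        Module.rank B (LinearMap.range f) + Module.rank B (LinearMap.range g) =
      Module.rank B V + Module.rank B (LinearMap.range (f ∘ₗ g)) := by
  rw [LinearMap.range_comp, ← LinearMap.range_domRestrict, ← LinearMap.rank_range_add_rank_ker f,
    ← Submodule.rank_quotient_add_rank ((LinearMap.range g).comap (LinearMap.ker f).subtype),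
    ← LinearMap.rank_range_add_rank_ker (f.domRestrict (LinearMap.range g)),
    rank_comap_subtype_comm, LinearMap.ker_domRestrict]
  ring

theorem finrank_homology_add_rank_toMatrix_add_rank_toMatrix {U V W : Type u} [AddCommGroup U]
    [Module B U] [AddCommGroup V] [Module B V] [AddCommGroup W] [Module B W] {I J K : Type*}
    [Fintype I] [Fintype J] [Finite K] [DecidableEq I] [DecidableEq J]
    (bU : Module.Basis I B U) (bV : Module.Basis J B V) (bW : Module.Basis K B W)
    (g : U →ₗ[B] V) (f : V →ₗ[B] W) :
    Module.finrank B (LinearMap.ker f ⧸ (LinearMap.range g).comap (LinearMap.ker f).subtype) +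
        (LinearMap.toMatrix bV bW f).rank + (LinearMap.toMatrix bU bV g).rank =
      Fintype.card J + (LinearMap.toMatrix bV bW f * LinearMap.toMatrix bU bV g).rank := by
  have := Module.Finite.of_basis bV
  have := Module.Finite.of_basis bW
  have hlt : Module.rank B (LinearMap.ker f ⧸ (LinearMap.range g).comap (LinearMap.ker f).subtype) <
      Cardinal.aleph0 :=
    (rank_quotient_le _).trans_lt
      ((Submodule.rank_le _).trans_lt (Module.rank_lt_aleph0 B V))
  have h := rank_homology_add_rank_range_add_rank_range g f
  rw [← Cardinal.cast_toNat_of_lt_aleph0 hlt] at h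
  simp only [← Submodule.finrank_eq_rank, ← Module.finrank_eq_rank B V] at h
  rw [Module.finrank_eq_card_basis bV, finrank_range_eq_rank_toMatrix bV bW,
    finrank_range_eq_rank_toMatrix bU bV, finrank_range_eq_rank_toMatrix bU bW,
    LinearMap.toMatrix_comp bU bV bW] at h
  exact_mod_cast h

end HomologyRank

/-! ## Coordinates with respect to representatives of free orbits -/

section FreeOrbits

variable (G : Type*) {E F : Type*} [Group G] [MulAction G E] [MulAction G F]

/-- The set of orbits of a group action; the chosen representative of an orbit `i` is `i.out`. -/
abbrev Orbits (E : Type*) [MulAction G E] : Type _ := MulAction.orbitRel.Quotient G E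

/-- The orbit of a point, as an element of the set of orbits. -/
def orbitClass (e : E) : Orbits G E := Quotient.mk'' e

theorem orbitClass_out (i : Orbits G E) : orbitClass G i.out = i := Quotient.out_eq' i

theorem exists_smul_out_orbitClass (e : E) : ∃ g : G, g • (orbitClass G e).out = e :=
  (MulAction.orbitRel G E).symm (Quotient.mk_out (s := MulAction.orbitRel G E) e)

/-- A group element that takes the representative of the orbit of `e` to `e`; it is unique if the
action is free. -/
def orbitShift (e : E) : G := (exists_smul_out_orbitClass G e).choose

theorem orbitShift_smul_out (e : E) : orbitShift G e • (orbitClass G e).out = e :=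
  (exists_smul_out_orbitClass G e).choose_spec

variable {G}

theorem orbitClass_eq_iff {e e' : E} : orbitClass G e = orbitClass G e' ↔ ∃ g : G, g • e' = e :=
  Quotient.eq''

theorem orbitClass_smul (g : G) (e : E) : orbitClass G (g • e) = orbitClass G e :=
  orbitClass_eq_iff.mpr ⟨g, rfl⟩

section Free

variable [IsCancelSMul G E]

theorem orbitShift_smul (g : G) (e : E) : orbitShift G (g • e) = g * orbitShift G e := by
  refine IsCancelSMul.right_cancel _ _ (orbitClass G e).out ?_
  rw [mul_smul, orbitShift_smul_out, ← orbitClass_smul g e, orbitShift_smul_out]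

theorem orbitShift_out (i : Orbits G E) : orbitShift G i.out = 1 := by
  have h := orbitShift_smul_out G i.out
  rw [orbitClass_out] at h
  exact IsCancelSMul.right_cancel _ _ i.out (h.trans (one_smul G _).symm)

end Free

variable {B : Type*} [CommRing B] {ν : Type*} [Fintype ν] [DecidableEq ν]

open Classical in
/-- The coordinates of `x ∈ ℤ[E]` in `ℤ[E] ⊗_σ B^ν`: a point `e` of the orbit `i` contributes the
matrix `σ(g)⁻¹` to the coordinate `i`, where `e = g • i.out`. -/
def orbitBlock (σ : G →* GL ν B) : (E →₀ ℤ) →ₗ[ℤ] (Orbits G E → Matrix ν ν B) :=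
  Finsupp.linearCombination ℤ fun e => Pi.single (orbitClass G e) (σ (orbitShift G e)⁻¹).1

open Classical in
theorem orbitBlock_single (σ : G →* GL ν B) (e : E) (n : ℤ) :
    orbitBlock σ (Finsupp.single e n) =
      n • Pi.single (orbitClass G e) (σ (orbitShift G e)⁻¹).1 :=
  Finsupp.linearCombination_single ..

theorem orbitBlock_lmapDomain_inv_smul [IsCancelSMul G E] (σ : G →* GL ν B) (g : G) (x : E →₀ ℤ)
    (i : Orbits G E) :
    orbitBlock σ (Finsupp.lmapDomain ℤ ℤ (g⁻¹ • ·) x) i = orbitBlock σ x i * (σ g).1 := by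
  classical
  induction x using Finsupp.induction_linear with
  | zero => simp only [map_zero, Pi.zero_apply, zero_mul]
  | add x y hx hy => simp only [map_add, Pi.add_apply, add_mul, hx, hy]
  | single e n =>
    rw [Finsupp.lmapDomain_apply, Finsupp.mapDomain_single, orbitBlock_single, orbitBlock_single,
      orbitClass_smul, orbitShift_smul, mul_inv_rev, inv_inv, map_mul, Units.val_mul,
      Pi.smul_apply, Pi.smul_apply, smul_mul_assoc, Pi.single_apply, Pi.single_apply, ite_mul,
      zero_mul]

theorem orbitBlock_map {C : Type*} [CommRing C] (f : B →+* C) (σ : G →* GL ν B) (x : E →₀ ℤ)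
    (i : Orbits G E) :
    orbitBlock ((Matrix.GeneralLinearGroup.map f).comp σ) x i = (orbitBlock σ x i).map f := by
  classical
  induction x using Finsupp.induction_linear with
  | zero => simp
  | add x y hx hy =>
    rw [map_add, map_add, Pi.add_apply, Pi.add_apply, hx, hy, Matrix.map_add _ (map_add f)]
  | single e n =>
    rw [orbitBlock_single, orbitBlock_single, Pi.smul_apply, Pi.smul_apply, Pi.single_apply,
      Pi.single_apply]
    split_ifs
    · exact Matrix.ext fun a b => (map_zsmul f n _).symm
    · simp only [smul_zero, Matrix.map_zero _ (map_zero f)]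

/-- The matrix of `d ⊗ id : ℤ[E] ⊗_σ B^ν → ℤ[F] ⊗_σ B^ν` with respect to the representatives of
the orbits of `E` and `F`. -/
def orbitMatrix (σ : G →* GL ν B) (d : (E →₀ ℤ) →ₗ[ℤ] (F →₀ ℤ)) :
    Matrix (Σ _ : Orbits G F, ν) (Σ _ : Orbits G E, ν) B :=
  .of fun u v => orbitBlock σ (d (Finsupp.single v.1.out 1)) u.1 u.2 v.2

theorem orbitMatrix_map {C : Type*} [CommRing C] (f : B →+* C) (σ : G →* GL ν B)
    (d : (E →₀ ℤ) →ₗ[ℤ] (F →₀ ℤ)) :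
    orbitMatrix ((Matrix.GeneralLinearGroup.map f).comp σ) d = (orbitMatrix σ d).map f := by
  ext u v
  simp only [orbitMatrix, orbitBlock_map, Matrix.of_apply, Matrix.map_apply]

end FreeOrbits

section Representations

variable {G : Type*} [Group G] {l : ℕ} {R : Type*} [CommRing R]

theorem contragredient_val (ρ : G →* GL (Fin l) R) (g : G) :
    (contragredient ρ g).1 = (ρ g⁻¹).1ᵀ := by
  rw [map_inv]
  rfl

variable {S : Type*} [CommRing S] [Algebra R S]

theorem twist_val (ρ : G →* GL (Fin l) R) (χ : G →* Sˣ) (g : G) :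
    (twist ρ χ g).1 = (χ g : S) • (ρ g).1.map (algebraMap R S) := by
  ext i j
  simp [twist, Matrix.scalar_apply]

theorem contragredient_twist (ρ : G →* GL (Fin l) R) (χ : G →* Sˣ) :
    contragredient (twist ρ χ) = twist (contragredient ρ) χ⁻¹ := by
  refine MonoidHom.ext fun g => Units.ext ?_
  rw [contragredient_val, twist_val, twist_val, contragredient_val, Matrix.transpose_smul,
    Matrix.transpose_map, MonoidHom.inv_apply, map_inv]

theorem map_comp_twist {T : Type*} [CommRing T] [Algebra R T] (f : S →ₐ[R] T)
    (ρ : G →* GL (Fin l) R) (χ : G →* Sˣ) :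
    (Matrix.GeneralLinearGroup.map (f : S →+* T)).comp (twist ρ χ) =
      twist ρ ((Units.map (f : S →* T)).comp χ) := by
  refine MonoidHom.ext fun g => Units.ext ?_
  change (twist ρ χ g).1.map f = _
  rw [twist_val, twist_val]
  ext i j
  simp

end Representations

/-! ## The matrices of the twisted complexes -/

section Cells

open Topology

variable {X : Type*} [TopologicalSpace X]

theorem actPath_fromPath_inv {x₀ x : X} (γ : Path.Homotopic.Quotient x₀ x₀)
    (w : Path.Homotopic.Quotient x₀ x) :
    actPath (FundamentalGroup.fromPath γ)⁻¹ w = γ.trans w :=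
  congrArg (Path.Homotopic.Quotient.trans · w)
    (congrArg FundamentalGroup.toPath (inv_inv (FundamentalGroup.fromPath γ)))

theorem exists_actPath_eq {x₀ x : X} (w w' : Path.Homotopic.Quotient x₀ x) :
    ∃ g : FundamentalGroup X x₀, actPath g w' = w :=
  ⟨(FundamentalGroup.fromPath (w.trans w'.symm))⁻¹, by
    rw [actPath_fromPath_inv, Path.Homotopic.Quotient.trans_assoc,
      Path.Homotopic.Quotient.symm_trans, Path.Homotopic.Quotient.trans_refl]⟩

theorem actPath_left_injective {x₀ x : X} (w : Path.Homotopic.Quotient x₀ x) :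
    Function.Injective fun g : FundamentalGroup X x₀ => actPath g w := fun g h hgh => by
  have hsymm : (FundamentalGroup.toPath g).symm = (FundamentalGroup.toPath h).symm := by
    simpa only [actPath, Path.Homotopic.Quotient.trans_assoc, Path.Homotopic.Quotient.trans_symm,
      Path.Homotopic.Quotient.trans_refl] using
      congrArg (Path.Homotopic.Quotient.trans · w.symm) hgh
  exact inv_injective hsymm

variable [CWComplex (Set.univ : Set X)] {x₀ : X} {k : ℕ}

instance : IsCancelSMul (FundamentalGroup X x₀) (LiftedCell x₀ k) where
  right_cancel' _ _ e h := actPath_left_injective e.2 (eq_of_heq (Sigma.mk.inj h).2)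

/-- The orbits of the `k`-cells of `X̃`. If `X` is connected, they are the `k`-cells of `X`; in
general, they are those that lie in the path component of the base point. -/
abbrev CellOrbits (x₀ : X) (k : ℕ) : Type _ := Orbits (FundamentalGroup X x₀) (LiftedCell x₀ k)

theorem orbitClass_eq_iff_fst_eq {e e' : LiftedCell x₀ k} :
    orbitClass (FundamentalGroup X x₀) e = orbitClass (FundamentalGroup X x₀) e' ↔
      e.1 = e'.1 := by
  refine orbitClass_eq_iff.trans ⟨fun ⟨g, hg⟩ => hg ▸ rfl, fun h => ?_⟩
  obtain ⟨i, w⟩ := e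
  obtain ⟨i', w'⟩ := e'
  obtain rfl : i = i' := h
  obtain ⟨g, hg⟩ := exists_actPath_eq w w'
  exact ⟨g, Sigma.ext rfl (heq_of_eq hg)⟩

instance [RelCWComplex.FiniteType (Set.univ : Set X)] : Finite (CellOrbits x₀ k) :=
  have : Finite (XCell X k) := RelCWComplex.FiniteType.finite_cell k
  Finite.of_injective (fun i => i.out.1) fun i j h => by
    rw [← orbitClass_out _ i, ← orbitClass_out _ j]
    exact orbitClass_eq_iff_fst_eq.mpr h

instance [RelCWComplex.FiniteType (Set.univ : Set X)] : Fintype (CellOrbits x₀ k) :=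
  Fintype.ofFinite _

end Cells

section Matrices

open Topology

variable {X : Type*} [TopologicalSpace X] [CWComplex (Set.univ : Set X)] {x₀ : X}
variable {B : Type*} [CommRing B] {l : ℕ} (σ : FundamentalGroup X x₀ →* GL (Fin l) B)

theorem deck_single {k : ℕ} (g : FundamentalGroup X x₀) (e : LiftedCell x₀ k) (n : ℤ) :
    deck g (Finsupp.single e n) = Finsupp.single (g • e) n :=
  Finsupp.mapDomain_single

/-- The coordinates of a twisted chain with respect to the representatives of the orbits of
cells, before passing to the quotient by the tensor relations. -/
def twChainCoord (k : ℕ) : (Fin l → B) ⊗[ℤ] Chains x₀ k →ₗ[B] (CellOrbits x₀ k → Fin l → B) :=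
  TensorProduct.AlgebraTensorModule.lift <|
    LinearMap.mk₂' B ℤ (fun v c i => orbitBlock σ c i *ᵥ v)
      (fun v w c => funext fun i => Matrix.mulVec_add _ v w)
      (fun b v c => funext fun i => Matrix.mulVec_smul _ b v)
      (fun v c d => funext fun i => by rw [map_add, Pi.add_apply, Matrix.add_mulVec]; rfl)
      (fun n v c => funext fun i => by rw [map_smul, Pi.smul_apply, Matrix.smul_mulVec]; rfl)

theorem twChainCoord_tmul {k : ℕ} (v : Fin l → B) (c : Chains x₀ k) (i : CellOrbits x₀ k) :
    twChainCoord σ k (v ⊗ₜ c) i = orbitBlock σ c i *ᵥ v := rfl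

open Classical in
theorem twChainCoord_tmul_single {k : ℕ} (v : Fin l → B) (e : LiftedCell x₀ k) (n : ℤ) :
    twChainCoord σ k (v ⊗ₜ Finsupp.single e n) =
      n • Pi.single (orbitClass _ e) ((σ (orbitShift _ e)⁻¹).1 *ᵥ v) := by
  funext i
  rw [twChainCoord_tmul, orbitBlock_single, Pi.smul_apply, Pi.smul_apply, Matrix.smul_mulVec,
    Pi.apply_single (fun _ A => A *ᵥ v) fun _ => Matrix.zero_mulVec v]

theorem tensorRelations_le_ker_twChainCoord (k : ℕ) :
    tensorRelations σ k ≤ LinearMap.ker (twChainCoord σ k) := by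
  rw [tensorRelations, Submodule.span_le]
  rintro _ ⟨g, v, x, rfl⟩
  refine LinearMap.mem_ker.mpr (funext fun i => ?_)
  rw [map_sub, Pi.sub_apply, twChainCoord_tmul, twChainCoord_tmul, deck,
    orbitBlock_lmapDomain_inv_smul, Matrix.mulVec_mulVec, sub_self, Pi.zero_apply]

theorem mkQ_tmul_single {k : ℕ} (v : Fin l → B) (e : LiftedCell x₀ k) (n : ℤ) :
    (tensorRelations σ k).mkQ (v ⊗ₜ Finsupp.single e n) =
      (tensorRelations σ k).mkQ
        (((σ (orbitShift _ e)⁻¹).1 *ᵥ v) ⊗ₜ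
          Finsupp.single (orbitClass (FundamentalGroup X x₀) e).out n) := by
  refine (Submodule.Quotient.eq _).mpr (Submodule.subset_span
    ⟨(orbitShift _ e)⁻¹, v, Finsupp.single (orbitClass (FundamentalGroup X x₀) e).out n, ?_⟩)
  rw [deck_single, inv_inv, orbitShift_smul_out]

/-- The twisted cochain with given values on the representatives of the orbits of cells. -/
def cochainOfValues {k : ℕ} (w : CellOrbits x₀ k → Fin l → B) : TwCochains σ k :=
  ⟨Finsupp.linearCombination ℤ fun e => (σ (orbitShift _ e)).1 *ᵥ w (orbitClass _ e), by
    intro g x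
    induction x using Finsupp.induction_linear with
    | zero => simp only [map_zero, Matrix.mulVec_zero]
    | add c d hc hd => simp only [map_add, hc, hd, Matrix.mulVec_add]
    | single e n =>
      rw [deck_single, Finsupp.linearCombination_single, Finsupp.linearCombination_single,
        orbitClass_smul, orbitShift_smul, map_mul, Units.val_mul, ← Matrix.mulVec_mulVec,
        Matrix.mulVec_smul]⟩

theorem cochainOfValues_single {k : ℕ}
    (w : CellOrbits x₀ k → Fin l → B) (e : LiftedCell x₀ k) (n : ℤ) :
    (cochainOfValues σ w).1 (Finsupp.single e n) =
      n • ((σ (orbitShift _ e)).1 *ᵥ w (orbitClass _ e)) :=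
  Finsupp.linearCombination_single ..

/-- Evaluation on the representatives of the orbits of cells identifies the twisted cochain
groups with free modules. -/
def twCochainsEquiv (k : ℕ) : TwCochains σ k ≃ₗ[B] (CellOrbits x₀ k → Fin l → B) where
  toFun c i := c.1 (Finsupp.single i.out 1)
  map_add' _ _ := rfl
  map_smul' _ _ := rfl
  invFun := cochainOfValues σ
  left_inv c := by
    refine Subtype.ext (Finsupp.lhom_ext fun e n => ?_)
    rw [cochainOfValues_single, ← c.2, deck_single, orbitShift_smul_out, ← map_smul,
      Finsupp.smul_single, smul_eq_mul, mul_one]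
  right_inv w := funext fun i => by
    beta_reduce
    rw [cochainOfValues_single, orbitShift_out, orbitClass_out, map_one, Units.val_one,
      Matrix.one_mulVec, one_smul]

open Classical in
theorem cochainOfValues_single_single_apply {k : ℕ}
    (i : CellOrbits x₀ k) (a b : Fin l) (c : Chains x₀ k) :
    (cochainOfValues σ (Pi.single i (Pi.single a 1))).1 c b =
      orbitBlock (contragredient σ) c i a b := by
  induction c using Finsupp.induction_linear with
  | zero => simp only [map_zero, Pi.zero_apply, Matrix.zero_apply]
  | add c d hc hd => simp only [map_add, Pi.add_apply, Matrix.add_apply, hc, hd]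
  | single e n =>
    rw [cochainOfValues_single, orbitBlock_single, contragredient_val, inv_inv, Pi.smul_apply,
      Pi.smul_apply, Matrix.smul_apply]
    obtain rfl | h := eq_or_ne i (orbitClass _ e)
    · rw [Pi.single_eq_same, Pi.single_eq_same, Matrix.mulVec_single_one, Matrix.transpose_apply]
      rfl
    · rw [Pi.single_eq_of_ne' h, Pi.single_eq_of_ne h, Matrix.mulVec_zero, Pi.zero_apply,
        Matrix.zero_apply]

variable [RelCWComplex.FiniteType (Set.univ : Set X)]

open Classical in
/-- The inverse of the identification of the twisted chain groups with free modules: it takes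
`v` at an orbit to `v ⊗ e` for the chosen representative `e`. -/
def twChainOfCoord (k : ℕ) : (CellOrbits x₀ k → Fin l → B) →ₗ[B] TwChains σ k :=
  LinearMap.lsum B (fun _ => Fin l → B) B fun i => (tensorRelations σ k).mkQ ∘ₗ
    (TensorProduct.AlgebraTensorModule.mk ℤ B (Fin l → B) (Chains x₀ k)).flip
      (Finsupp.single i.out 1)

open Classical in
theorem twChainOfCoord_single {k : ℕ} (i : CellOrbits x₀ k) (v : Fin l → B) :
    twChainOfCoord σ k (Pi.single i v) =
      (tensorRelations σ k).mkQ (v ⊗ₜ Finsupp.single i.out 1) :=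
  LinearMap.lsum_piSingle ..

theorem twChainOfCoord_twChainCoord {k : ℕ} (z : (Fin l → B) ⊗[ℤ] Chains x₀ k) :
    twChainOfCoord σ k (twChainCoord σ k z) = (tensorRelations σ k).mkQ z := by
  classical
  induction z using TensorProduct.induction_on with
  | zero => simp only [map_zero]
  | add y z hy hz => simp only [map_add, hy, hz]
  | tmul v c =>
    induction c using Finsupp.induction_linear with
    | zero => simp only [TensorProduct.tmul_zero, map_zero]
    | add c d hc hd => simp only [TensorProduct.tmul_add, map_add, hc, hd]
    | single e n =>
      rw [twChainCoord_tmul_single, map_zsmul, twChainOfCoord_single, mkQ_tmul_single σ v e,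
        ← map_zsmul, ← TensorProduct.tmul_smul, Finsupp.smul_single, smul_eq_mul, mul_one]

/-- The identification of the twisted chain groups with free modules, given by the
representatives of the orbits of cells. -/
def twChainsEquiv (k : ℕ) : TwChains σ k ≃ₗ[B] (CellOrbits x₀ k → Fin l → B) :=
  LinearEquiv.ofLinearMap
    ((tensorRelations σ k).liftQ (twChainCoord σ k) (tensorRelations_le_ker_twChainCoord σ k))
    (twChainOfCoord σ k)
    (by
      classical
      refine LinearMap.pi_ext fun i v => ?_
      rw [LinearMap.comp_apply, twChainOfCoord_single, Submodule.mkQ_apply,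
        Submodule.liftQ_apply, twChainCoord_tmul_single, orbitShift_out, orbitClass_out, inv_one,
        map_one, Units.val_one, Matrix.one_mulVec, one_smul, LinearMap.id_apply])
    (Submodule.linearMap_qext _ (LinearMap.ext (twChainOfCoord_twChainCoord σ)))

/-- The basis of the twisted chain group given by the representatives of the orbits of cells. -/
def twChainsBasis (k : ℕ) :
    Module.Basis (Σ _ : CellOrbits x₀ k, Fin l) B (TwChains σ k) :=
  (Pi.basis fun _ => Pi.basisFun B (Fin l)).map (twChainsEquiv σ k).symm

/-- The basis of the twisted cochain group given by the representatives of the orbits of cells. -/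
def twCochainsBasis (k : ℕ) :
    Module.Basis (Σ _ : CellOrbits x₀ k, Fin l) B (TwCochains σ k) :=
  (Pi.basis fun _ => Pi.basisFun B (Fin l)).map (twCochainsEquiv σ k).symm

open Classical in
theorem toMatrix_twBoundary (k : ℕ) :
    LinearMap.toMatrix (twChainsBasis σ k) (twChainsBasis σ (k - 1)) (twBoundary σ k) =
      orbitMatrix σ (boundary x₀ k) := by
  ext u v
  have hbasis : twChainsBasis σ k v =
      (tensorRelations σ k).mkQ (Pi.single v.2 1 ⊗ₜ Finsupp.single v.1.out 1) := by
    rw [twChainsBasis, Module.Basis.map_apply, Pi.basis_apply, Pi.basisFun_apply]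
    exact twChainOfCoord_single ..
  have hcoord (z : TwChains σ (k - 1)) :
      (twChainsBasis σ (k - 1)).repr z u = twChainsEquiv σ (k - 1) z u.1 u.2 := by
    simp only [twChainsBasis, Module.Basis.map_repr, LinearEquiv.trans_apply,
      LinearEquiv.symm_symm, Pi.basis_repr, Pi.basisFun_repr]
  rw [LinearMap.toMatrix_apply, hbasis, hcoord]
  change (orbitBlock σ _ u.1 *ᵥ Pi.single v.2 1) u.2 = _
  rw [Matrix.mulVec_single_one]
  rfl

open Classical in
theorem toMatrix_twCoboundary (k : ℕ) :
    LinearMap.toMatrix (twCochainsBasis σ (k - 1)) (twCochainsBasis σ k) (twCoboundary σ k) =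
      (orbitMatrix (contragredient σ) (boundary x₀ k))ᵀ := by
  ext u v
  have hbasis : twCochainsBasis σ (k - 1) v =
      cochainOfValues σ (Pi.single v.1 (Pi.single v.2 1)) := by
    rw [twCochainsBasis, Module.Basis.map_apply, Pi.basis_apply, Pi.basisFun_apply]
    rfl
  have hcoord (c : TwCochains σ k) :
      (twCochainsBasis σ k).repr c u = c.1 (Finsupp.single u.1.out 1) u.2 := by
    simp only [twCochainsBasis, Module.Basis.map_repr, LinearEquiv.trans_apply,
      LinearEquiv.symm_symm, Pi.basis_repr, Pi.basisFun_repr]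
    rfl
  rw [LinearMap.toMatrix_apply, hbasis, hcoord]
  exact cochainOfValues_single_single_apply ..

end Matrices

section Betti

open Topology

variable {X : Type*} [TopologicalSpace X] [CWComplex (Set.univ : Set X)] {x₀ : X}
variable {B : Type*} [CommRing B] {l : ℕ} (σ : FundamentalGroup X x₀ →* GL (Fin l) B) (k : ℕ)

theorem bettiHomology_eq_finrank :
    bettiHomology σ k = Module.finrank B (TwHomology σ k) :=
  finrank_fractionRing_tensorProduct

theorem bettiCohomology_eq_finrank :
    bettiCohomology σ k = Module.finrank B (TwCohomology σ k) :=
  finrank_fractionRing_tensorProduct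

variable [RelCWComplex.FiniteType (Set.univ : Set X)] [IsDomain B]

theorem bettiHomology_add_rank_add_rank :
    bettiHomology σ k + (orbitMatrix σ (boundary x₀ k)).rank +
        (orbitMatrix (F := LiftedCell x₀ k) σ (boundary x₀ (k + 1))).rank =
      Fintype.card (Σ _ : CellOrbits x₀ k, Fin l) +
        (orbitMatrix σ (boundary x₀ k) *
          orbitMatrix (F := LiftedCell x₀ k) σ (boundary x₀ (k + 1))).rank := by
  classical
  have h := finrank_homology_add_rank_toMatrix_add_rank_toMatrix (twChainsBasis σ (k + 1))
    (twChainsBasis σ k) (twChainsBasis σ (k - 1)) (twBoundary σ (k + 1)) (twBoundary σ k)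
  have hsucc : LinearMap.toMatrix (twChainsBasis σ (k + 1)) (twChainsBasis σ k)
      (twBoundary σ (k + 1)) = orbitMatrix (F := LiftedCell x₀ k) σ (boundary x₀ (k + 1)) :=
    toMatrix_twBoundary σ (k + 1)
  rwa [toMatrix_twBoundary, hsucc, ← bettiHomology_eq_finrank] at h

theorem bettiCohomology_eq_bettiHomology_contragredient :
    bettiCohomology σ k = bettiHomology (contragredient σ) k := by
  classical
  have h := finrank_homology_add_rank_toMatrix_add_rank_toMatrix (twCochainsBasis σ (k - 1))
    (twCochainsBasis σ k) (twCochainsBasis σ (k + 1)) (twCoboundary σ k) (twCoboundary σ (k + 1))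
  have hsucc : LinearMap.toMatrix (twCochainsBasis σ k) (twCochainsBasis σ (k + 1))
      (twCoboundary σ (k + 1)) =
        (orbitMatrix (F := LiftedCell x₀ k) (contragredient σ) (boundary x₀ (k + 1)))ᵀ :=
    toMatrix_twCoboundary σ (k + 1)
  rw [toMatrix_twCoboundary, hsucc, ← Matrix.transpose_mul, rank_transpose_of_isDomain,
    rank_transpose_of_isDomain, rank_transpose_of_isDomain] at h
  have h' := bettiHomology_add_rank_add_rank (contragredient σ) k
  rw [bettiCohomology_eq_finrank]
  change Module.finrank B (TwCohomology σ k) + _ + _ = _ at h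
  omega

theorem exists_ne_zero_bettiHomology_map_eq :
    ∃ b : B, b ≠ 0 ∧ ∀ {C : Type*} [CommRing C] [IsDomain C] (f : B →+* C), f b ≠ 0 →
      bettiHomology ((Matrix.GeneralLinearGroup.map f).comp σ) k = bettiHomology σ k := by
  obtain ⟨b₁, hb₁, h₁⟩ := exists_ne_zero_rank_map_eq (orbitMatrix σ (boundary x₀ k))
  obtain ⟨b₂, hb₂, h₂⟩ := exists_ne_zero_rank_map_eq
    (orbitMatrix (F := LiftedCell x₀ k) σ (boundary x₀ (k + 1)))
  obtain ⟨b₃, hb₃, h₃⟩ := exists_ne_zero_rank_map_eq (orbitMatrix σ (boundary x₀ k) *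
    orbitMatrix (F := LiftedCell x₀ k) σ (boundary x₀ (k + 1)))
  refine ⟨b₁ * b₂ * b₃, mul_ne_zero (mul_ne_zero hb₁ hb₂) hb₃, fun f hf => ?_⟩
  rw [map_mul, map_mul, mul_ne_zero_iff, mul_ne_zero_iff] at hf
  have h := bettiHomology_add_rank_add_rank σ k
  have hmap := bettiHomology_add_rank_add_rank ((Matrix.GeneralLinearGroup.map f).comp σ) k
  rw [orbitMatrix_map, orbitMatrix_map, ← Matrix.map_mul, h₁ f hf.1.1, h₂ f hf.1.2, h₃ f hf.2]
    at hmap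
  omega

theorem bettiHomology_map_of_injective {C : Type*} [CommRing C] [IsDomain C] {f : B →+* C}
    (hf : Function.Injective f) :
    bettiHomology ((Matrix.GeneralLinearGroup.map f).comp σ) k = bettiHomology σ k := by
  obtain ⟨b, hb, h⟩ := exists_ne_zero_bettiHomology_map_eq σ k
  exact h f ((map_ne_zero_iff f hf).mpr hb)

end Betti

/-! ## Specializations of the Laurent polynomial representation -/

section Characters

variable {G : Type*} [Group G] {l m : ℕ}

theorem map_lift_comp_laurentRep {R S : Type*} [CommRing R] [CommRing S] [Algebra R S]
    (ρ : G →* GL (Fin l) R) (q : G →* Multiplicative (Fin m → ℤ))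
    (χ : Multiplicative (Fin m → ℤ) →* S) :
    (Matrix.GeneralLinearGroup.map (AddMonoidAlgebra.lift R S _ χ : Laurent R m →+* S)).comp
      (laurentRep ρ q) = twist ρ (MonoidHom.toHomUnits (χ.comp q)) := by
  rw [laurentRep, map_comp_twist]
  congr 1
  exact MonoidHom.ext fun g => Units.ext (AddMonoidAlgebra.lift_of (R := R) χ (q g))

theorem contragredient_twist_toHomUnits {R S : Type*} [CommRing R] [CommRing S] [Algebra R S]
    (ρ : G →* GL (Fin l) R) {χ χ' : G →* S} (h : ∀ g, χ g⁻¹ = χ' g) :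
    contragredient (twist ρ (MonoidHom.toHomUnits χ)) =
      twist (contragredient ρ) (MonoidHom.toHomUnits χ') := by
  rw [contragredient_twist]
  congr 1
  refine MonoidHom.ext fun g => ?_
  rw [MonoidHom.inv_apply, ← map_inv]
  exact Units.ext (h g)

theorem contragredient_expDeformation (ρ : G →* GL (Fin l) ℂ) (α : Additive G →+ ℂ) (t : ℂ) :
    contragredient (expDeformation ρ α t) = expDeformation (contragredient ρ) (-α) t :=
  contragredient_twist_toHomUnits ρ fun g =>
    congrArg (fun a => Complex.exp (t * a)) (map_neg α (Additive.ofMul g))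

theorem contragredient_formalDeformation (ρ : G →* GL (Fin l) ℂ) (α : Additive G →+ ℂ) :
    contragredient (formalDeformation ρ α) = formalDeformation (contragredient ρ) (-α) :=
  contragredient_twist_toHomUnits ρ fun g =>
    congrArg formalExp (map_neg α (Additive.ofMul g))

variable (β : (Fin m → ℤ) →+ ℂ)

/-- The specialization of Laurent polynomials that sends the monomial `a` to `e^{t β(a)}`; it turns
`laurentRep ρ q` into the exponential deformation of `ρ` along `β ∘ q`. -/
def expEval (t : ℂ) : Laurent ℂ m →ₐ[ℂ] ℂ :=
  AddMonoidAlgebra.lift ℂ ℂ (Fin m → ℤ)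
    { toFun := fun a => Complex.exp (t * β a.toAdd)
      map_one' := by simp
      map_mul' := fun a b => by simp [mul_add, Complex.exp_add] }

/-- The homomorphism from Laurent polynomials to power series that sends the monomial `a` to the
formal exponential `e^{t β(a)}`; it turns `laurentRep ρ q` into the formal exponential deformation
of `ρ` along `β ∘ q`. -/
def formalEval : Laurent ℂ m →ₐ[ℂ] PowerSeries ℂ :=
  AddMonoidAlgebra.lift ℂ (PowerSeries ℂ) (Fin m → ℤ)
    { toFun := fun a => formalExp (β a.toAdd)
      map_one' := by
        ext n
        rcases n with _ | n <;> simp [formalExp, PowerSeries.coeff_one]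
      map_mul' := fun a b => by simp [formalExp, PowerSeries.exp_mul_exp_eq_exp_add] }

theorem expEval_apply (t : ℂ) (x : Laurent ℂ m) :
    expEval β t x = x.coeff.sum fun a r => r * Complex.exp (t * β a) := by
  rw [expEval, AddMonoidAlgebra.lift_apply]
  rfl

theorem coeff_formalEval (x : Laurent ℂ m) (n : ℕ) :
    PowerSeries.coeff n (formalEval β x) =
      (x.coeff.sum fun a r => r * β a ^ n) * (n.factorial : ℂ)⁻¹ := by
  rw [formalEval, AddMonoidAlgebra.lift_apply, Finsupp.sum, Finsupp.sum, map_sum, Finset.sum_mul]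
  refine Finset.sum_congr rfl fun a _ => ?_
  simp [formalExp, PowerSeries.coeff_rescale, PowerSeries.coeff_exp, mul_assoc]

theorem map_expEval_comp_laurentRep (ρ : G →* GL (Fin l) ℂ)
    (q : G →* Multiplicative (Fin m → ℤ)) (t : ℂ) :
    (Matrix.GeneralLinearGroup.map (expEval β t : Laurent ℂ m →+* ℂ)).comp (laurentRep ρ q) =
      expDeformation ρ (β.comp q.toAdditiveLeft) t :=
  map_lift_comp_laurentRep ρ q _

theorem map_formalEval_comp_laurentRep (ρ : G →* GL (Fin l) ℂ)
    (q : G →* Multiplicative (Fin m → ℤ)) :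
    (Matrix.GeneralLinearGroup.map (formalEval β : Laurent ℂ m →+* PowerSeries ℂ)).comp
      (laurentRep ρ q) = formalDeformation ρ (β.comp q.toAdditiveLeft) :=
  map_lift_comp_laurentRep ρ q _

end Characters

section Specialization

theorem exists_sum_mul_monoidHom_ne_zero {ι M L : Type*} [MulOneClass M] [CommRing L] [IsDomain L]
    {χ : ι → M →* L} (hχ : Function.Injective χ) {c : ι →₀ L} (hc : c ≠ 0) :
    ∃ s, (c.sum fun i a => a * χ i s) ≠ 0 := by
  by_contra! h
  refine hc (linearIndependent_iff.mp ((linearIndependent_monoidHom M L).comp χ hχ) c ?_)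
  funext s
  rw [Finsupp.linearCombination_apply, Finsupp.sum, Finset.sum_apply]
  exact h s

theorem exp_mul_right_injective :
    Function.Injective fun a t : ℂ => Complex.exp (t * a) := by
  have hderiv (a : ℂ) : deriv (fun t : ℂ => Complex.exp (t * a)) 0 = a := by
    simp
  intro a b hab
  rw [← hderiv a, ← hderiv b]
  exact congrArg (deriv · 0) hab

variable {m : ℕ} {β : (Fin m → ℤ) →+ ℂ} (hβ : Function.Injective β)
include hβ

theorem formalEval_injective : Function.Injective (formalEval β) := by
  refine (injective_iff_map_eq_zero _).mpr fun x hx => ?_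
  by_contra hx₀
  obtain ⟨n, hn⟩ := exists_sum_mul_monoidHom_ne_zero (χ := fun a => powersHom ℂ (β a))
    ((powersHom ℂ).injective.comp hβ) fun h => hx₀ (AddMonoidAlgebra.coeff_injective h)
  refine mul_ne_zero hn (inv_ne_zero (Nat.cast_ne_zero.mpr n.toAdd.factorial_ne_zero)) ?_
  exact (coeff_formalEval β x n.toAdd).symm.trans (by rw [hx, map_zero])

theorem exists_expEval_ne_zero {x : Laurent ℂ m} (hx : x ≠ 0) : ∃ t, expEval β t x ≠ 0 := by
  let χ (a : Fin m → ℤ) : Multiplicative ℂ →* ℂ :=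
    { toFun := fun t => Complex.exp (t.toAdd * β a)
      map_one' := by simp
      map_mul' := fun s t => by simp [add_mul, Complex.exp_add] }
  have hχ : Function.Injective χ := fun a b hab =>
    hβ (exp_mul_right_injective (congrArg DFunLike.coe hab))
  obtain ⟨t, ht⟩ := exists_sum_mul_monoidHom_ne_zero hχ
    fun h => hx (AddMonoidAlgebra.coeff_injective h)
  exact ⟨t.toAdd, (expEval_apply β t.toAdd x).trans_ne ht⟩

theorem eventually_codiscrete_expEval_ne_zero {x : Laurent ℂ m} (hx : x ≠ 0) :
    ∀ᶠ t in Filter.codiscrete ℂ, expEval β t x ≠ 0 := by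
  obtain ⟨t, ht⟩ := exists_expEval_ne_zero hβ hx
  have hanalytic : AnalyticOnNhd ℂ (fun t => expEval β t x) Set.univ := by
    simp only [expEval_apply, Finsupp.sum]
    exact Complex.analyticOnNhd_univ_iff_differentiable.mpr (by fun_prop)
  exact hanalytic.preimage_zero_mem_codiscrete ht

end Specialization

section Deformations

open Topology

variable {X : Type*} [TopologicalSpace X] [CWComplex (Set.univ : Set X)]
  [RelCWComplex.FiniteType (Set.univ : Set X)] {x₀ : X} {l n m : ℕ}

theorem bettiLaurent_eq_bettiHomology_repP {R : Type*} [CommRing R] [IsDomain R]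
    (ρ : FundamentalGroup X x₀ →* GL (Fin l) R) (θ : H1Free x₀ ≃* Multiplicative (Fin n → ℤ))
    (p : (Fin n → ℤ) →+ (Fin m → ℤ)) (k : ℕ) :
    bettiLaurent ρ θ p k = bettiHomology (repP ρ θ p) k := by
  rw [bettiLaurent, ← bettiHomology_eq_finrank]
  exact bettiHomology_map_of_injective _ k (IsFractionRing.injective _ _)

variable (ρ : FundamentalGroup X x₀ →* GL (Fin l) ℂ)
  (q : FundamentalGroup X x₀ →* Multiplicative (Fin m → ℤ)) {β : (Fin m → ℤ) →+ ℂ}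
  (hβ : Function.Injective β) (k : ℕ)
include hβ

theorem bettiHomology_formalDeformation :
    bettiHomology (formalDeformation ρ (β.comp q.toAdditiveLeft)) k =
      bettiHomology (laurentRep ρ q) k := by
  rw [← map_formalEval_comp_laurentRep]
  exact bettiHomology_map_of_injective _ k (formalEval_injective hβ)

theorem bettiCohomology_formalDeformation :
    bettiCohomology (formalDeformation ρ (β.comp q.toAdditiveLeft)) k =
      bettiHomology (laurentRep (contragredient ρ) q) k := by
  rw [bettiCohomology_eq_bettiHomology_contragredient, contragredient_formalDeformation,
    ← AddMonoidHom.neg_comp]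
  exact bettiHomology_formalDeformation _ q (neg_injective.comp hβ) k

theorem eventually_codiscrete_bettiHomology_expDeformation :
    ∀ᶠ t in Filter.codiscrete ℂ, bettiHomology (expDeformation ρ (β.comp q.toAdditiveLeft) t) k =
      bettiHomology (laurentRep ρ q) k := by
  obtain ⟨b, hb, h⟩ := exists_ne_zero_bettiHomology_map_eq (laurentRep ρ q) k
  filter_upwards [eventually_codiscrete_expEval_ne_zero hβ hb] with t ht
  rw [← map_expEval_comp_laurentRep]
  exact h _ ht

theorem eventually_codiscrete_bettiCohomology_expDeformation :
    ∀ᶠ t in Filter.codiscrete ℂ, bettiCohomology (expDeformation ρ (β.comp q.toAdditiveLeft) t) k =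
      bettiHomology (laurentRep (contragredient ρ) q) k := by
  filter_upwards [eventually_codiscrete_bettiHomology_expDeformation (contragredient ρ) q
    (β := -β) (neg_injective.comp hβ) k] with t ht
  rwa [bettiCohomology_eq_bettiHomology_contragredient, contragredient_expDeformation,
    ← AddMonoidHom.neg_comp]

end Deformations

/-! ## The Novikov ring -/

section Novikov

variable {R : Type*} [CommRing R] {m : ℕ} {η : (Fin m → ℤ) →+ ℝ}

theorem laurentToNovikov_single (a : NovExp η) (r : R) :
    laurentToNovikov R η (AddMonoidAlgebra.single (M := Fin m → ℤ) a r) =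
      NovikovRing.monomial a r := by
  have h : laurentToNovikov R η (AddMonoidAlgebra.single (M := Fin m → ℤ) a r) =
      NovikovRing.monomial 0 r * NovikovRing.monomial (η := η) a 1 :=
    AddMonoidAlgebra.liftNC_single _ _ _ _
  exact h.trans (Subtype.ext (HahnSeries.single_mul_single.trans (by rw [zero_add, mul_one]; rfl)))

theorem coeff_laurentToNovikov (x : Laurent R m) (a : Fin m → ℤ) :
    (laurentToNovikov R η x).1.coeff a = x.coeff a := by
  induction x using AddMonoidAlgebra.induction_linear with
  | zero => rw [map_zero]; rfl
  | add x y hx hy =>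
    rw [map_add, AddMonoidAlgebra.coeff_add, Finsupp.add_apply, ← hx, ← hy]
    rfl
  | single b r =>
    refine (congrArg (fun f : NovikovRing R η => f.1.coeff a)
      (laurentToNovikov_single b r)).trans ?_
    obtain rfl | h := eq_or_ne a b
    · exact (HahnSeries.coeff_single_same a r).trans Finsupp.single_eq_same.symm
    · exact (HahnSeries.coeff_single_of_ne h).trans (Finsupp.single_eq_of_ne h).symm

theorem laurentToNovikov_injective : Function.Injective (laurentToNovikov R η) := fun x y h =>
  AddMonoidAlgebra.coeff_injective <| Finsupp.ext fun a => by
    rw [← coeff_laurentToNovikov (η := η) x a, h, coeff_laurentToNovikov]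

theorem NovExp.le_total_of_injective (hη : Function.Injective η) (a b : NovExp η) :
    a ≤ b ∨ b ≤ a := by
  rcases lt_trichotomy a.height b.height with h | h | h
  · exact Or.inr (Or.inr h)
  · exact Or.inl (Or.inl (hη h))
  · exact Or.inl (Or.inr h)

theorem isDomain_novikovRing [IsDomain R] (hη : Function.Injective η) :
    IsDomain (NovikovRing R η) := by
  classical
  let _ : LinearOrder (NovExp η) :=
    { (inferInstance : PartialOrder (NovExp η)) with
      le_total := NovExp.le_total_of_injective hη
      toDecidableLE := Classical.decRel _ }
  have : IsDomain (HahnSeries (NovExp η) R) := NoZeroDivisors.to_isDomain _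
  infer_instance

open Topology

variable {X : Type*} [TopologicalSpace X] [CWComplex (Set.univ : Set X)]
  [RelCWComplex.FiniteType (Set.univ : Set X)]

theorem novikovBetti_eq_bettiHomology_repP [IsDomain R] {x₀ : X} {l n : ℕ}
    (ρ : FundamentalGroup X x₀ →* GL (Fin l) R) (θ : H1Free x₀ ≃* Multiplicative (Fin n → ℤ))
    (p : (Fin n → ℤ) →+ (Fin m → ℤ)) (hη : Function.Injective η) (k : ℕ) :
    novikovBetti ρ θ p η k = bettiHomology (repP ρ θ p) k :=
  have := isDomain_novikovRing (R := R) hη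
  bettiHomology_map_of_injective _ k laurentToNovikov_injective

end Novikov

section Main

theorem exists_isClosed_isDiscrete_of_eventually_codiscrete {Y : Type*} [TopologicalSpace Y]
    {P : Y → Prop} (h : ∀ᶠ t in Filter.codiscrete Y, P t) :
    ∃ S : Set Y, IsClosed S ∧ IsDiscrete S ∧ ∀ t, t ∉ S → P t := by
  obtain ⟨hopen, hdiscrete⟩ := mem_codiscrete'.mp h
  exact ⟨_, hopen.isClosed_compl, hdiscrete, fun _ => not_not.mp⟩

theorem freeProj_surjective {X : Type*} [TopologicalSpace X] {x₀ : X} {n : ℕ}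
    (θ : H1Free x₀ ≃* Multiplicative (Fin n → ℤ)) : Function.Surjective (freeProj θ) :=
  θ.surjective.comp ((QuotientGroup.mk'_surjective _).comp QuotientGroup.mk_surjective)

end Main

end ExpDeform

end

open ExpDeform

theorem mainTheorem1_general {X : Type*} [TopologicalSpace X]
    [Topology.CWComplex (Set.univ : Set X)] [Topology.RelCWComplex.FiniteType (Set.univ : Set X)]
    (x₀ : X) {l : ℕ} (ρ : FundamentalGroup X x₀ →* GL (Fin l) ℂ)
    (α : Additive (FundamentalGroup X x₀) →+ ℂ)
    {n m : ℕ} (θ : H1Free x₀ ≃* Multiplicative (Fin n → ℤ))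
    (p : (Fin n → ℤ) →+ (Fin m → ℤ)) (hp : Function.Surjective p)
    (α' : (Fin m → ℤ) →+ ℂ) (hα' : Function.Injective α')
    (hfac : ∀ g : FundamentalGroup X x₀,
      α (Additive.ofMul g) = α' (p (Multiplicative.toAdd (freeProj θ g))))
    (k : ℕ) :
    (∃ S : Set ℂ, IsClosed S ∧ IsDiscrete S ∧ ∀ t : ℂ, t ∉ S →
      bettiHomology (expDeformation ρ α t) k = bettiHomology (formalDeformation ρ α) k ∧
      bettiCohomology (expDeformation ρ α t) k = bettiCohomology (formalDeformation ρ α) k) ∧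
    bettiHomology (formalDeformation ρ α) k = bettiLaurent ρ θ p k ∧
    bettiCohomology (formalDeformation ρ α) k = bettiLaurent (contragredient ρ) θ p k ∧
    (∀ ξ : Additive (FundamentalGroup X x₀) →+ ℝ,
      (∀ g : FundamentalGroup X x₀, α (Additive.ofMul g) = (ξ (Additive.ofMul g) : ℂ)) →
      ∀ ξ' : (Fin m → ℤ) →+ ℝ,
      (∀ g : FundamentalGroup X x₀,
        ξ (Additive.ofMul g) = ξ' (p (Multiplicative.toAdd (freeProj θ g)))) →
      bettiHomology (formalDeformation ρ α) k = novikovBetti ρ θ p ξ' k ∧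
      bettiCohomology (formalDeformation ρ α) k =
        novikovBetti (contragredient ρ) θ p ξ' k) := by
  let q := p.toMultiplicative.comp (freeProj θ)
  have hq : Function.Surjective fun g => p (freeProj θ g).toAdd :=
    hp.comp (freeProj_surjective θ)
  obtain rfl : α = α'.comp q.toAdditiveLeft := AddMonoidHom.ext hfac
  have hform := bettiHomology_formalDeformation ρ q hα' k
  have hcoform := bettiCohomology_formalDeformation ρ q hα' k
  simp only [bettiLaurent_eq_bettiHomology_repP]
  refine ⟨exists_isClosed_isDiscrete_of_eventually_codiscrete ?_, hform, hcoform,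
    fun ξ hξ ξ' hξ' => ?_⟩
  · filter_upwards [eventually_codiscrete_bettiHomology_expDeformation ρ q hα' k,
      eventually_codiscrete_bettiCohomology_expDeformation ρ q hα' k] with t hexp hcoexp
    exact ⟨hexp.trans hform.symm, hcoexp.trans hcoform.symm⟩
  · have hα'ξ' : ⇑α' = Complex.ofReal ∘ ξ' := hq.injective_comp_right <| funext fun g =>
      (hfac g).symm.trans ((hξ g).trans (congrArg Complex.ofReal (hξ' g)))
    have hξ'_inj : Function.Injective ξ' := .of_comp (hα'ξ' ▸ hα')
    exact ⟨hform.trans (novikovBetti_eq_bettiHomology_repP ρ θ p hξ'_inj k).symm,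
      hcoform.trans (novikovBetti_eq_bettiHomology_repP (contragredient ρ) θ p hξ'_inj k).symm⟩

theorem mainTheorem1 {X : Type*} [TopologicalSpace X] [T2Space X] [ConnectedSpace X]
    [Topology.CWComplex (Set.univ : Set X)] [Topology.RelCWComplex.Finite (Set.univ : Set X)]
    (x₀ : X) {l : ℕ} (ρ : FundamentalGroup X x₀ →* GL (Fin l) ℂ)
    (α : Additive (FundamentalGroup X x₀) →+ ℂ)
    -- the factorization of `α` as `G → H_1(X, ℤ)/Tors ≅ ℤ^n → ℤ^m → ℂ` with `m = Irr α`
    {n : ℕ} (θ : ExpDeform.H1Free x₀ ≃* Multiplicative (Fin n → ℤ))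
    (p : (Fin n → ℤ) →+ (Fin (ExpDeform.irr α) → ℤ)) (hp : Function.Surjective p)
    (α' : (Fin (ExpDeform.irr α) → ℤ) →+ ℂ) (hα' : Function.Injective α')
    (hfac : ∀ g : FundamentalGroup X x₀,
      α (Additive.ofMul g) = α' (p (Multiplicative.toAdd (ExpDeform.freeProj θ g))))
    (k : ℕ) :
    -- the Betti numbers of `γ_t` for generic `t` are those of the formal deformation
    (∃ S : Set ℂ, IsClosed S ∧ IsDiscrete S ∧ ∀ t : ℂ, t ∉ S →
      ExpDeform.bettiHomology (ExpDeform.expDeformation ρ α t) k =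
        ExpDeform.bettiHomology (ExpDeform.formalDeformation ρ α) k ∧
      ExpDeform.bettiCohomology (ExpDeform.expDeformation ρ α t) k =
        ExpDeform.bettiCohomology (ExpDeform.formalDeformation ρ α) k) ∧
    -- they are the Betti numbers of the Laurent polynomial complex
    ExpDeform.bettiHomology (ExpDeform.formalDeformation ρ α) k =
      ExpDeform.bettiLaurent ρ θ p k ∧
    ExpDeform.bettiCohomology (ExpDeform.formalDeformation ρ α) k =
      ExpDeform.bettiLaurent (ExpDeform.contragredient ρ) θ p k ∧
    -- for real `α` they are the twisted Novikov Betti numbers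
    (∀ ξ : Additive (FundamentalGroup X x₀) →+ ℝ,
      (∀ g : FundamentalGroup X x₀, α (Additive.ofMul g) = (ξ (Additive.ofMul g) : ℂ)) →
      ∀ ξ' : (Fin (ExpDeform.irr α) → ℤ) →+ ℝ,
      (∀ g : FundamentalGroup X x₀,
        ξ (Additive.ofMul g) = ξ' (p (Multiplicative.toAdd (ExpDeform.freeProj θ g)))) →
      ExpDeform.bettiHomology (ExpDeform.formalDeformation ρ α) k =
        ExpDeform.novikovBetti ρ θ p ξ' k ∧
      ExpDeform.bettiCohomology (ExpDeform.formalDeformation ρ α) k =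
        ExpDeform.novikovBetti (ExpDeform.contragredient ρ) θ p ξ' k) :=
  mainTheorem1_general x₀ ρ α θ p hp α' hα' hfac k
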